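/- Let $n,k,l$ be integers with $2\le l\le k\le n/2$ and let $p\in\mathbb R$. Write $x=(x_1,\dots,x_n)$, $B^+=\{x\in\mathbb R^n: |x|<1,\ x_n>0\}$, $\overline{B^+}$ for its closure, and $\partial' B^+=\{x: |x|<1,\ x_n=0\}$. For a symmetric matrix $M$ let $\sigma_s(M)$ be the $s$-th elementary symmetric polynomial of its eigenvalues ($\sigma_0=1$), and let $\Gamma_k$ be the set of symmetric $n\times n$ matrices $M$ with $\sigma_i(M)>0$ for $1\le i\le k$. For a $C^2$ function $w$ put $$A[w]=e^{-2w}\Big(-\nabla^2 w+\nabla w\otimes\nabla w-\tfrac12|\nabla w|^2 I\Big),$$ let $A[w]^T$ be the block of the first $n-1$ rows and columns of $A[w]$, and put $$\mathcal B^l[w]=-\sum_{s=0}^{l-1}\alpha(l,s)\,\sigma_s(A[w]^T)\Big(e^{-w}\frac{\partial w}{\partial x_n}\Big)^{2l-2s-1},\qquad \alpha(l,s)=\frac{(n-1-s)!}{(n-l)!\,(2l-2s-1)!!}.$$ Let $u\in C^2(\overline{B^+}\setminus\{0\})$ and $v\in C^2(\overline{B^+})$ satisfy $A[u]\in\Gamma_k$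 in $\overline{B^+}\setminus\{0\}$ and $A[v]\in\Gamma_k$ in $\overline{B^+}$. Assume that $$e^{pu}\sigma_k(A[u])\ge e^{pv}\sigma_k(A[v])\ \text{ in } B^+,\qquad \mathcal B^l[u]\ge\mathcal B^l[v]\ge 0\ \text{ on }\partial' B^+\setminus\{0\},$$ and that $u>v$ in $B^+$. Then $$\liminf_{x\to0,\ x\in\overline{B^+}\setminus\{0\}}(u-v)(x)>0,$$ where the value $+\infty$ of the lower limit is allowed. -/

import Mathlib

open scoped Topology

noncomputable section

namespace SigmaK

/-- Euclidean space `ℝⁿ` with `n = d + 1`. The coordinates are indexed by `Fin (d + 1)`; the first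
`d = n - 1` of them (`Fin.castSucc α`, `α : Fin d`) are the tangential ones and the last one
(`Fin.last d`) is the normal coordinate `x_n`. -/
abbrev Space (d : ℕ) := EuclideanSpace ℝ (Fin (d + 1))

/-- The open upper half ball `B⁺ = {x | |x| < 1, x_n > 0}`. -/
def halfBall (d : ℕ) : Set (Space d) := {x | ‖x‖ < 1 ∧ 0 < x (Fin.last d)}

/-- The closed upper half ball, which is the closure of `B⁺`, see `closure_halfBall`. -/
def closedHalfBall (d : ℕ) : Set (Space d) := {x | ‖x‖ ≤ 1 ∧ 0 ≤ x (Fin.last d)}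

/-- The flat part `∂'B⁺` of the boundary: the interior, relative to the hyperplane `x_n = 0`,
of `∂B⁺ ∩ {x_n = 0}`. -/
def flatBoundary (d : ℕ) : Set (Space d) := {x | ‖x‖ < 1 ∧ x (Fin.last d) = 0}

theorem closure_halfBall (d : ℕ) : closure (halfBall d) = closedHalfBall d := by
  apply Set.Subset.antisymm
  · apply closure_minimal
    · exact fun x hx => ⟨hx.1.le, hx.2.le⟩
    · exact (isClosed_le continuous_norm continuous_const).inter
        (isClosed_le continuous_const
          (by fun_prop : Continuous fun y : Space d => y (Fin.last d)))
  · intro x hx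
    set p : Space d := EuclideanSpace.single (Fin.last d) (1 / 2 : ℝ) with hp
    have hpn : ‖p‖ = 1 / 2 := by simp [hp]
    have hpl : p (Fin.last d) = 1 / 2 := by simp [hp]
    have hc : Continuous (fun t : ℝ => (1 - t) • x + t • p) := by fun_prop
    have ht : Filter.Tendsto (fun t : ℝ => (1 - t) • x + t • p) (𝓝[>] 0) (𝓝 x) := by
      have h0 := (hc.tendsto 0).mono_left (nhdsWithin_le_nhds (s := Set.Ioi 0))
      simpa using h0
    refine mem_closure_of_tendsto ht ?_
    filter_upwards [Ioo_mem_nhdsGT (show (0 : ℝ) < 1 by norm_num)] with t ht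
    have h1 : 0 < t := ht.1
    have h2 : 0 < 1 - t := by linarith [ht.2]
    constructor
    · calc ‖(1 - t) • x + t • p‖ ≤ ‖(1 - t) • x‖ + ‖t • p‖ := norm_add_le _ _
        _ = (1 - t) * ‖x‖ + t * (1 / 2) := by
          rw [norm_smul, norm_smul, hpn, Real.norm_of_nonneg h1.le, Real.norm_of_nonneg h2.le]
        _ < 1 := by nlinarith [hx.1]
    · have h3 := mul_nonneg h2.le hx.2
      have h4 : ((1 - t) • x + t • p) (Fin.last d)
          = (1 - t) * x (Fin.last d) + t * (1 / 2) := by simp [hpl]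
      rw [h4]
      linarith

/-- The elementary symmetric function `σ_k(λ(M))` of the eigenvalues of the real matrix `M`,
listed with multiplicity as the roots of its characteristic polynomial; it is only used for
symmetric matrices, all of whose eigenvalues are real. In particular `σ_0(M) = 1`. -/
def sigma {ι : Type*} [Fintype ι] [DecidableEq ι] (k : ℕ) (M : Matrix ι ι ℝ) : ℝ :=
  M.charpoly.roots.esymm k

theorem sigma_eq_esymm_eigenvalues {ι : Type*} [Fintype ι] [DecidableEq ι] (k : ℕ)
    {M : Matrix ι ι ℝ} (hM : M.IsHermitian) :
    sigma k M = (Finset.univ.val.map hM.eigenvalues).esymm k := by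
  rw [sigma, hM.roots_charpoly_eq_eigenvalues]
  rfl

/-- The cone `Γ_k` of symmetric matrices `M` with `σ_i(M) > 0` for `1 ≤ i ≤ k`. -/
def Gam {ι : Type*} [Fintype ι] [DecidableEq ι] (k : ℕ) : Set (Matrix ι ι ℝ) :=
  {M | M.IsSymm ∧ ∀ i, 1 ≤ i → i ≤ k → 0 < sigma i M}

/-- The partial derivative `∂v/∂x_i` of a function `v` given on the set `S`. Derivatives are taken
within `S`, so that they are the derivatives up to the boundary for functions of class `C²` on
`closedHalfBall d` or on `closedHalfBall d \ {0}`, and the usual ones at interior points of `S`. -/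
def partialDeriv {d : ℕ} (S : Set (Space d)) (v : Space d → ℝ) (i : Fin (d + 1))
    (x : Space d) : ℝ :=
  fderivWithin ℝ v S x (EuclideanSpace.single i 1)

/-- The conformal Hessian `A[v] = e^{-2v} (-∇²v + ∇v ⊗ ∇v - ½ |∇v|² I)` of a function `v` given
on the set `S`. -/
def confHess {d : ℕ} (S : Set (Space d)) (v : Space d → ℝ) (x : Space d) :
    Matrix (Fin (d + 1)) (Fin (d + 1)) ℝ :=
  Matrix.of fun i j => Real.exp (-2 * v x) *
    (-partialDeriv S (partialDeriv S v j) i x + partialDeriv S v i x * partialDeriv S v j x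
      - 1 / 2 * (∑ m, partialDeriv S v m x ^ 2) * (if i = j then 1 else 0))

/-- The tangential part `M^T` of a matrix: the block of the first `n - 1` rows and columns. -/
def tangential {d : ℕ} (M : Matrix (Fin (d + 1)) (Fin (d + 1)) ℝ) : Matrix (Fin d) (Fin d) ℝ :=
  M.submatrix Fin.castSucc Fin.castSucc

/-- The constants `α(k,s) = (n-1-s)! / ((n-k)! (2k-2s-1)!!)`, used for `0 ≤ s < k ≤ n / 2`. -/
def alphaCoeff (n k s : ℕ) : ℝ :=
  (Nat.factorial (n - 1 - s) : ℝ) /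
    ((Nat.factorial (n - k) : ℝ) * (Nat.doubleFactorial (2 * k - 2 * s - 1) : ℝ))

/-- The boundary curvature
`𝓑^k[v] = - ∑_{s=0}^{k-1} α(k,s) σ_s(A[v]^T) (e^{-v} ∂v/∂x_n)^{2k-2s-1}`
of a function `v` given on the set `S`. -/
def boundaryB {d : ℕ} (S : Set (Space d)) (k : ℕ) (v : Space d → ℝ) (x : Space d) : ℝ :=
  -∑ s ∈ Finset.range k, alphaCoeff (d + 1) k s * sigma s (tangential (confHess S v x)) *
    (Real.exp (-v x) * partialDeriv S v (Fin.last d) x) ^ (2 * k - 2 * s - 1)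

end SigmaK

end

/-! The proof turns u > v into a cone-shaped gap at the origin by comparison, and then turns the
cone into a positive gap by superharmonicity.

Perturb v to v + ε q with q = -|x|² + μ x_n + M x_n² + ⟨a, x⟩ + m. On jets in the Gårding cone, the
boundary operator strictly decreases in the normal derivative and does not see the (n,n) entry of
the Hessian, while the interior operator strictly decreases in that entry. Hence μ can be chosen
first and M afterwards so that v + ε q has strictly smaller operators than v, uniformly for small x,
a, m (`exists_strict_perturbation`). Such a function cannot touch u from below away from the origin
(`not_touch_of_strict`): in the interior by ellipticity, on the flat boundary by monotonicity of the
boundary operator in the tangential Hessian and in the normal derivative, where B ≥ 0 supplies the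
sign ∂u/∂x_n ≤ 0.

For m = 0 one has q = O(|x|), and u - v ≥ 0, so the minimum of u - v - ε q, if negative, is not
approached at the origin; small parameters also keep it off the outer sphere. Therefore v + ε q ≤ u
for every small a, and letting a point along x gives u ≥ v + ε (q₀ + α |x|), where q₀ is q with a =
0 and m = 0 (`exists_cone_below`). Expanding v at 0, u ≥ v(0) + ⟨b, x⟩ + δ |x|.

From here only Δu < 0 (from Γ_1) and ∂u/∂x_n ≤ 0 matter. The slope b_n may have the wrong sign, but
a barrier with the term x_n log(R/|x|) improves the cone bound enough to absorb it near 0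
(`log_improvement`). With b tangential, the minimum principle, with the puncture removed by ε log
|x|, carries the gap δR on the sphere |x| = R to the origin (`gap_of_tangential_cone`). As v - ⟨b,
x⟩ is continuous at 0 with value v(0), the lower limit is positive. -/

namespace SigmaK

open Polynomial

/-! ### Elementary symmetric functions: Newton's inequality and deletion of a variable. -/

theorem esymm_cons (a : ℝ) (t : Multiset ℝ) (j : ℕ) :
    (a ::ₘ t).esymm (j + 1) = t.esymm (j + 1) + a * t.esymm j := by
  simp [Multiset.esymm, Multiset.powersetCard_cons, Multiset.map_map,
    Multiset.sum_map_mul_left]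

theorem esymm_eq_zero_of_card_lt (t : Multiset ℝ) {j : ℕ} (h : t.card < j) : t.esymm j = 0 := by
  simp [Multiset.esymm, Multiset.powersetCard_eq_empty _ h]

/-- By Rolle, p' loses at most one root against p, and its degree drops as well. -/
theorem splits_derivative {p : ℝ[X]} (hp : p.Splits) : p.derivative.Splits := by
  rw [splits_iff_card_roots] at hp ⊢
  have h1 := card_roots_le_derivative p
  have h2 := natDegree_derivative_le p
  have h3 := card_roots' p.derivative
  have h4 : p.natDegree = 0 → p.derivative = 0 := fun h => by
    rw [eq_C_of_natDegree_eq_zero h]; simp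
  by_cases h0 : p.natDegree = 0
  · simp [h4 h0]
  · omega

theorem splits_iterate_derivative {p : ℝ[X]} (hp : p.Splits) (m : ℕ) :
    (derivative^[m] p).Splits := by
  induction m with
  | zero => simpa using hp
  | succ m ih => rw [Function.iterate_succ_apply']; exact splits_derivative ih

/-- Laguerre's inequality for polynomials with only real roots. -/
theorem eval_mul_derivative_derivative_le {p : ℝ[X]} (hp : p.Splits) (x : ℝ) :
    p.eval x * p.derivative.derivative.eval x ≤ p.derivative.eval x ^ 2 := by
  have key : ∀ s : Multiset ℝ, ∀ c : ℝ, ∀ q : ℝ[X], q = C c * (s.map fun a => X - C a).prod →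
      q.eval x * q.derivative.derivative.eval x ≤ q.derivative.eval x ^ 2 := by
    intro s c
    induction s using Multiset.induction_on with
    | empty => rintro q rfl; simp
    | cons a s ih =>
      intro q hq
      set r := C c * (s.map fun a => X - C a).prod with hr
      have h := ih r rfl
      have : q = (X - C a) * r := by rw [hq, hr, Multiset.map_cons, Multiset.prod_cons]; ring
      have h1 : q.derivative = r + (X - C a) * r.derivative := by
        rw [this, derivative_mul]; simp
      have h2 : q.derivative.derivative = 2 * r.derivative + (X - C a) * r.derivative.derivative := by
        rw [h1, derivative_add, derivative_mul]; simp; ring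
      rw [h2, h1, this]
      simp only [eval_add, eval_mul, eval_sub, eval_X, eval_C, eval_ofNat]
      -- For q = (X - a) r one has q'² - q q'' = r² + (x - a)² (r'² - r r'').
      nlinarith [mul_nonneg (sq_nonneg (x - a)) (sub_nonneg.2 h), sq_nonneg (eval x r)]
  exact key p.roots p.leadingCoeff p hp.eq_prod_roots

/-- A weak form of Newton's inequality. -/
theorem esymm_mul_esymm_le_sq (t : Multiset ℝ) (j : ℕ)
    (h : 0 ≤ t.esymm (j + 2) * t.esymm j) :
    t.esymm (j + 2) * t.esymm j ≤ t.esymm (j + 1) ^ 2 := by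
  by_cases hj : t.card < j + 2
  · rw [esymm_eq_zero_of_card_lt t hj, zero_mul]; positivity
  push Not at hj
  obtain ⟨m, hm⟩ := Nat.exists_eq_add_of_le hj
  set p : ℝ[X] := (t.map fun a => X + C a).prod with hp
  have hs : p.Splits := by
    rw [hp]
    apply Splits.multisetProd
    intro f hf
    obtain ⟨a, -, rfl⟩ := Multiset.mem_map.1 hf
    exact Splits.X_add_C a
  have hc : ∀ i, i ≤ t.card → p.coeff i = t.esymm (t.card - i) := fun i hi =>
    Multiset.prod_X_add_C_coeff t hi
  -- At 0, the m-th derivative of p and its next two derivatives take the values m! e_{j+2}, (m+1)!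
  -- e_{j+1}, (m+2)! e_j.
  have L := eval_mul_derivative_derivative_le (splits_iterate_derivative hs m) 0
  have e1 : (derivative^[m] p).derivative = derivative^[m + 1] p := by
    rw [Function.iterate_succ_apply']
  have e2 : (derivative^[m+1] p).derivative = derivative^[m + 2] p := by
    rw [Function.iterate_succ_apply' _ (m + 1)]
  rw [e1, e2, ← coeff_zero_eq_eval_zero, ← coeff_zero_eq_eval_zero, ← coeff_zero_eq_eval_zero,
    coeff_iterate_derivative, coeff_iterate_derivative, coeff_iterate_derivative] at L
  simp only [zero_add, Nat.descFactorial_self] at L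
  rw [hc m (by omega), hc (m + 1) (by omega), hc (m + 2) (by omega),
    show t.card - m = j + 2 by omega, show t.card - (m + 1) = j + 1 by omega,
    show t.card - (m + 2) = j by omega] at L
  simp only [nsmul_eq_mul, Nat.factorial_succ] at L
  push_cast at L
  have hf : (0 : ℝ) < (m.factorial : ℝ) := by exact_mod_cast m.factorial_pos
  have hm0 : (0 : ℝ) ≤ m := Nat.cast_nonneg m
  set A := t.esymm (j + 2) * t.esymm j
  set f : ℝ := (m.factorial : ℝ)
  -- Since (m+1)!² ≤ m! (m+2)!, the sign of A allows the sharp Newton constant to be dropped.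
  have : (f * (m + 1)) ^ 2 * A ≤ (f * (m + 1)) ^ 2 * t.esymm (j + 1) ^ 2 := by
    have e : (f * (m + 1)) * (f * (m + 2)) * A ≤ (f * (m + 1)) ^ 2 * t.esymm (j + 1) ^ 2 := by
      have : (f * (m + 1)) * (f * (m + 2)) * A
        = f * t.esymm (j + 2) * ((m + 1 + 1) * ((m + 1) * f) * t.esymm j) := by
        simp only [A]; ring
      rw [this]
      refine L.trans (le_of_eq (by ring))
    refine le_trans ?_ e
    apply mul_le_mul_of_nonneg_right _ h
    rw [sq]
    gcongr
    linarith
  exact le_of_mul_le_mul_left this (by positivity)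

/-- Deleting one variable maps the Gårding cone `Γ_{k+1}` into `Γ_k`. -/
theorem esymm_pos_of_cons (a : ℝ) (t : Multiset ℝ) (k : ℕ)
    (h : ∀ i ≤ k + 1, 0 < (a ::ₘ t).esymm i) : ∀ i ≤ k, 0 < t.esymm i := by
  induction k with
  | zero =>
    intro i hi
    obtain rfl : i = 0 := by omega
    simp [Multiset.esymm]
  | succ k ih =>
    have ih' := ih fun i hi => h i (by omega)
    intro i hi
    rcases Nat.lt_or_ge i (k + 1) with hlt | hge
    · exact ih' i (by omega)
    obtain rfl : i = k + 1 := by omega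
    -- If e_{k+1} ≤ 0, the two positive functions of the longer list force a > 0 and e_{k+2} e_k >
    -- -a e_{k+1} e_k ≥ e_{k+1}², against Newton.
    by_contra! hneg
    have h1 := h (k + 1) (by omega)
    have h2 := h (k + 2) (by omega)
    rw [esymm_cons] at h1 h2
    have h0 := ih' k le_rfl
    set e0 := t.esymm k
    set e1 := t.esymm (k + 1)
    set e2 := t.esymm (k + 2)
    have ha : 0 < a := by
      by_contra! ha
      nlinarith [mul_nonpos_of_nonpos_of_nonneg ha h0.le]
    have h3 : 0 < e2 := by nlinarith [mul_nonpos_of_nonneg_of_nonpos ha.le hneg]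
    have h4 := esymm_mul_esymm_le_sq t k (mul_pos h3 h0).le
    nlinarith [mul_pos h2 h0, mul_nonneg_of_nonpos_of_nonpos hneg hneg,
      mul_nonneg (neg_nonneg.2 hneg) h1.le]

end SigmaK

/-! ### Characteristic polynomials, rank-one updates and the Gårding cone. -/

namespace SigmaK

open Polynomial Matrix

/-- Multiplying by the adjugate replaces A by a scalar matrix, so the determinant is read off from
the characteristic polynomial of a rank-one matrix. No inverse is needed, so this applies to
characteristic matrices over ℝ[X]. -/
theorem det_add_vecMulVec {R ι : Type*} [CommRing R] [IsDomain R] [Fintype ι] [DecidableEq ι]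
    {A : Matrix ι ι R} (hA : A.det ≠ 0) (u v : ι → R) :
    (A + vecMulVec u v).det = A.det + v ⬝ᵥ (A.adjugate *ᵥ u) := by
  cases isEmpty_or_nonempty ι
  · simp
  have hn : Fintype.card ι = Fintype.card ι - 1 + 1 :=
    (Nat.sub_add_cancel Fintype.card_pos).symm
  have h1 : A.adjugate * (A + vecMulVec u v)
      = A.det • (1 : Matrix ι ι R) - vecMulVec (-(A.adjugate *ᵥ u)) v := by
    rw [mul_add, adjugate_mul, mul_vecMulVec, neg_vecMulVec, sub_neg_eq_add]
  have h2 := congrArg det h1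
  have h3 : (A.det • (1 : Matrix ι ι R) - vecMulVec (-(A.adjugate *ᵥ u)) v).det
      = (vecMulVec (-(A.adjugate *ᵥ u)) v).charpoly.eval A.det := by
    rw [eval_charpoly, smul_one_eq_diagonal]; rfl
  rw [h3, charpoly_vecMulVec, det_mul, det_adjugate] at h2
  have h4 : A.det ^ (Fintype.card ι - 1) ≠ 0 := pow_ne_zero _ hA
  apply mul_left_cancel₀ h4
  rw [h2, dotProduct_comm v]
  simp only [eval_sub, eval_pow, eval_X, eval_smul, smul_eq_mul, neg_dotProduct]
  nth_rewrite 1 [hn]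
  rw [pow_succ]
  ring

section

variable {ι : Type*} [Fintype ι] [DecidableEq ι]

/-- The elementary symmetric function of the eigenvalues, as a polynomial in the entries. -/
noncomputable def esig (k : ℕ) (M : Matrix ι ι ℝ) : ℝ := (-M).charpoly.coeff (Fintype.card ι - k)

theorem charmatrix_neg_diagonal (a : ι → ℝ) :
    charmatrix (-diagonal a) = diagonal fun i => X + C (a i) := by
  ext1 i j
  by_cases h : i = j
  · subst h; simp
  · simp [h]

theorem charpoly_neg_eq_prod {M : Matrix ι ι ℝ} (hM : M.IsHermitian) :
    (-M).charpoly = ∏ i, (X + C (hM.eigenvalues i)) := by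
  have h := hM.spectral_theorem
  rw [Unitary.conjStarAlgAut_apply] at h
  have h2 : -M = (hM.eigenvectorUnitary : Matrix ι ι ℝ) *
      (-diagonal (hM.eigenvalues)) * (star hM.eigenvectorUnitary : Matrix ι ι ℝ) := by
    rw [mul_neg, neg_mul]
    exact congrArg _ h
  rw [h2, charpoly_mul_comm, ← mul_assoc, Unitary.coe_star_mul_self, one_mul, charpoly,
    charmatrix_neg_diagonal, det_diagonal]

/-- The coefficient of `s` in the characteristic polynomial of `-(M + s ξ ξᵀ)`. -/
noncomputable def rankOneCoeff (M : Matrix ι ι ℝ) (ξ : ι → ℝ) : ℝ[X] :=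
  (fun i => C (ξ i)) ⬝ᵥ ((charmatrix (-M)).adjugate *ᵥ fun i => C (ξ i))

theorem charpoly_neg_add_rankOne (M : Matrix ι ι ℝ) (ξ : ι → ℝ) (s : ℝ) :
    (-(M + s • vecMulVec ξ ξ)).charpoly = (-M).charpoly + C s * rankOneCoeff M ξ := by
  have h : charmatrix (-(M + s • vecMulVec ξ ξ))
      = charmatrix (-M) + vecMulVec (C s • fun i => C (ξ i)) fun i => C (ξ i) := by
    ext1 i j
    simp [charmatrix_apply, vecMulVec_apply]
    ring
  rw [charpoly, h, det_add_vecMulVec (charpoly_monic (-M)).ne_zero, mulVec_smul, dotProduct_smul,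
    smul_eq_mul]
  rfl

theorem rankOneCoeff_diagonal (a ξ : ι → ℝ) :
    rankOneCoeff (diagonal a) ξ
      = ∑ i, C (ξ i ^ 2) * ∏ j ∈ Finset.univ.erase i, (X + C (a j)) := by
  rw [rankOneCoeff, charmatrix_neg_diagonal, adjugate_diagonal, dotProduct]
  refine Finset.sum_congr rfl fun i _ => ?_
  rw [mulVec_diagonal, C_pow]
  ring

/-- The weights are the squared coordinates of ξ in an eigenbasis. The identity follows by comparing
the characteristic polynomials of the update before and after conjugation. -/
theorem rankOneCoeff_eq_sum {M : Matrix ι ι ℝ} (hM : M.IsHermitian) (ξ : ι → ℝ) :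
    ∃ w : ι → ℝ, (∀ i, 0 ≤ w i) ∧ rankOneCoeff M ξ
      = ∑ i, C (w i) * ∏ j ∈ Finset.univ.erase i, (X + C (hM.eigenvalues j)) := by
  set U : Matrix ι ι ℝ := (hM.eigenvectorUnitary : Matrix ι ι ℝ) with hU
  set D := diagonal hM.eigenvalues with hD
  have h : M = U * D * star U := by
    have h := hM.spectral_theorem
    rwa [Unitary.conjStarAlgAut_apply] at h
  have hUU : star U * U = 1 := Unitary.coe_star_mul_self _
  have hUU' : U * star U = 1 := Unitary.coe_mul_star_self _
  have hst : star U = Uᵀ := by rw [star_eq_conjTranspose]; ext; simp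
  set η : ι → ℝ := star U *ᵥ ξ with hη
  have hv : vecMulVec ξ ξ = U * vecMulVec η η * star U := by
    rw [hη, mul_vecMulVec, vecMulVec_mul, mulVec_mulVec, hUU', one_mulVec, hst]
    congr 1
    rw [← mulVec_transpose, transpose_transpose, mulVec_mulVec, ← hst, hUU', one_mulVec]
  refine ⟨fun i => η i ^ 2, fun i => sq_nonneg _, ?_⟩
  rw [← rankOneCoeff_diagonal]
  have h1 := charpoly_neg_add_rankOne M ξ 1
  have h2 := charpoly_neg_add_rankOne D η 1
  have h3 : M + (1 : ℝ) • vecMulVec ξ ξ = U * (D + (1 : ℝ) • vecMulVec η η) * star U := by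
    rw [one_smul, one_smul, mul_add, add_mul, ← hv, ← h]
  have inv : ∀ N : Matrix ι ι ℝ, (-(U * N * star U)).charpoly = (-N).charpoly := fun N => by
    rw [← neg_mul, ← mul_neg, charpoly_mul_comm, ← mul_assoc, hUU, one_mul]
  rw [h3, inv, h2] at h1
  have e : (-M).charpoly = (-D).charpoly := by
    conv_lhs => rw [h]
    exact inv D
  rw [e] at h1
  simpa using (add_left_cancel h1).symm

theorem esig_zero (M : Matrix ι ι ℝ) : esig 0 M = 1 := by
  have := (charpoly_monic (-M)).coeff_natDegree
  rwa [charpoly_natDegree_eq_dim] at this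

/-- The bound on k matters: beyond the size of M, truncated subtraction makes `esig` the constant
coefficient instead of 0. -/
theorem esig_eq_esymm {M : Matrix ι ι ℝ} (hM : M.IsHermitian) {k : ℕ} (hk : k ≤ Fintype.card ι) :
    esig k M = (Finset.univ.val.map hM.eigenvalues).esymm k := by
  have h := Multiset.prod_X_add_C_coeff (Finset.univ.val.map hM.eigenvalues)
    (k := Fintype.card ι - k) (by simp)
  rw [esig, charpoly_neg_eq_prod hM]
  rw [Multiset.map_map] at h
  refine h.trans ?_
  congr 1
  simp
  omega

theorem sigma_eq_esig {M : Matrix ι ι ℝ} (hM : M.IsSymm) {k : ℕ} (hk : k ≤ Fintype.card ι) :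
    sigma k M = esig k M := by
  have hM' : M.IsHermitian := by rw [IsHermitian, conjTranspose_eq_transpose_of_trivial]; exact hM
  rw [sigma_eq_esymm_eigenvalues k hM', esig_eq_esymm hM' hk]

/-- The Gårding cone `Γ_k`, written with the polynomials `esig`. -/
def PosCone (k : ℕ) (M : Matrix ι ι ℝ) : Prop := M.IsHermitian ∧ ∀ i ≤ k, 0 < esig i M

theorem PosCone.mono {k l : ℕ} {M : Matrix ι ι ℝ} (h : PosCone k M) (hl : l ≤ k) : PosCone l M :=
  ⟨h.1, fun i hi => h.2 i (hi.trans hl)⟩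

/-- On `Γ_{k+1}` the coefficients of `rankOneCoeff` are the values of a nonnegative combination of
the elementary symmetric functions with one variable deleted. -/
theorem PosCone.rankOneCoeff_coeff {k : ℕ} (hk : k + 1 ≤ Fintype.card ι) {M : Matrix ι ι ℝ}
    (hM : PosCone (k + 1) M) (ξ : ι → ℝ) :
    (∀ i ≤ k, 0 ≤ (rankOneCoeff M ξ).coeff (Fintype.card ι - (i + 1))) ∧
      (rankOneCoeff M ξ ≠ 0 →
        ∀ i ≤ k, 0 < (rankOneCoeff M ξ).coeff (Fintype.card ι - (i + 1))) := by
  obtain ⟨w, hw, h⟩ := rankOneCoeff_eq_sum hM.1 ξ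
  set a := hM.1.eigenvalues
  have hcons : ∀ i, Finset.univ.val.map a = a i ::ₘ ((Finset.univ.erase i).val.map a) := fun i => by
    rw [← Multiset.map_cons, Finset.erase_val, Multiset.cons_erase (Finset.mem_univ_val i)]
  have hpos : ∀ i, ∀ j ≤ k, 0 < ((Finset.univ.erase i).val.map a).esymm j := fun i => by
    apply esymm_pos_of_cons (a i)
    intro j hj
    rw [← hcons, ← esig_eq_esymm hM.1 (by omega)]
    exact hM.2 j hj
  have hc : ∀ j ≤ k, (rankOneCoeff M ξ).coeff (Fintype.card ι - (j + 1))
      = ∑ i, w i * ((Finset.univ.erase i).val.map a).esymm j := by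
    intro j hj
    rw [h, finsetSum_coeff]
    refine Finset.sum_congr rfl fun i _ => ?_
    have h := Multiset.prod_X_add_C_coeff ((Finset.univ.erase i).val.map a)
      (k := Fintype.card ι - (j + 1)) (by simp; omega)
    rw [Multiset.map_map] at h
    rw [coeff_C_mul]
    congr 1
    refine h.trans ?_
    congr 1
    simp
    omega
  constructor
  · intro j hj
    rw [hc j hj]
    exact Finset.sum_nonneg fun i _ => mul_nonneg (hw i) (hpos i j hj).le
  · intro h0 j hj
    rw [hc j hj]
    obtain ⟨i, hi⟩ : ∃ i, w i ≠ 0 := by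
      by_contra! hall
      exact h0 (by rw [h]; simp [hall])
    exact Finset.sum_pos' (fun i _ => mul_nonneg (hw i) (hpos i j hj).le)
      ⟨i, Finset.mem_univ _, mul_pos (lt_of_le_of_ne (hw i) (Ne.symm hi)) (hpos i j hj)⟩

theorem esig_succ_add_rankOne (k : ℕ) (M : Matrix ι ι ℝ) (ξ : ι → ℝ) (s : ℝ) :
    esig (k + 1) (M + s • vecMulVec ξ ξ)
      = esig (k + 1) M + s * (rankOneCoeff M ξ).coeff (Fintype.card ι - (k + 1)) := by
  rw [esig, charpoly_neg_add_rankOne, coeff_add, coeff_C_mul, esig]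

/-- Each `esig` is affine along a rank-one direction, with nonnegative slope by
`PosCone.rankOneCoeff_coeff`. -/
theorem PosCone.add_rankOne {k : ℕ} (hk : k ≤ Fintype.card ι) {M : Matrix ι ι ℝ}
    (hM : PosCone k M) (ξ : ι → ℝ) :
    PosCone k (M + vecMulVec ξ ξ) ∧ ∀ i ≤ k, esig i M ≤ esig i (M + vecMulVec ξ ξ) := by
  have hle : ∀ i ≤ k, esig i M ≤ esig i (M + vecMulVec ξ ξ) := by
    intro i hi
    rcases i with _ | i
    · rw [esig_zero, esig_zero]
    · have h := esig_succ_add_rankOne i M ξ 1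
      rw [one_smul] at h
      rw [h, one_mul]
      have := ((hM.mono hi).rankOneCoeff_coeff (by omega) ξ).1 i le_rfl
      linarith
  refine ⟨⟨hM.1.add ?_, fun i hi => (hM.2 i hi).trans_le (hle i hi)⟩, hle⟩
  ext i j
  simp [vecMulVec_apply, mul_comm]

/-- The elementary symmetric functions are nondecreasing on the Gårding cone. -/
theorem PosCone.add_posSemidef {k : ℕ} (hk : k ≤ Fintype.card ι) {M N : Matrix ι ι ℝ}
    (hM : PosCone k M) (hN : N.PosSemidef) :
    PosCone k (M + N) ∧ ∀ i ≤ k, esig i M ≤ esig i (M + N) := by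
  obtain ⟨m, v, rfl⟩ := posSemidef_iff_eq_sum_vecMulVec.1 hN
  clear hN
  induction m with
  | zero => simpa using hM
  | succ m ih =>
    obtain ⟨h1, h2⟩ := ih fun i => v i.castSucc
    rw [Fin.sum_univ_castSucc, ← add_assoc]
    obtain ⟨h3, h4⟩ := h1.add_rankOne hk (v (Fin.last m))
    exact ⟨h3, fun i hi => (h2 i hi).trans (h4 i hi)⟩

end

/-- For ξ = e_n the quadratic form of the adjugate is the last diagonal cofactor. Hence σ_k of the
tangential block is the derivative of σ_{k+1} in the (n,n) entry. -/
theorem rankOneCoeff_last {d : ℕ} (M : Matrix (Fin (d + 1)) (Fin (d + 1)) ℝ) :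
    rankOneCoeff M (Pi.single (Fin.last d) 1) = (-(tangential M)).charpoly := by
  have h : (fun i => C ((Pi.single (Fin.last d) 1 : Fin (d + 1) → ℝ) i))
      = (Pi.single (Fin.last d) 1 : Fin (d + 1) → ℝ[X]) := by
    ext1 i
    by_cases hi : i = Fin.last d
    · subst hi; simp
    · simp [hi]
  rw [rankOneCoeff, h, single_one_dotProduct, mulVec_single_one, col_apply,
    adjugate_fin_succ_eq_det_submatrix, charpoly, Even.neg_one_pow (by simp), one_mul]
  congr 1
  ext1 i j
  simp [charmatrix_apply, tangential, diagonal_apply]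

theorem esig_succ_add_last {d : ℕ} (k : ℕ) (M : Matrix (Fin (d + 1)) (Fin (d + 1)) ℝ) (s : ℝ) :
    esig (k + 1) (M + s • vecMulVec (Pi.single (Fin.last d) 1) (Pi.single (Fin.last d) 1))
      = esig (k + 1) M + s * esig k (tangential M) := by
  rw [esig_succ_add_rankOne, rankOneCoeff_last, esig]
  simp [esig]

theorem PosCone.tangential {d k : ℕ} (hk : k ≤ d) {M : Matrix (Fin (d + 1)) (Fin (d + 1)) ℝ}
    (hM : PosCone (k + 1) M) : PosCone k (tangential M) := by
  refine ⟨hM.1.submatrix _, fun i hi => ?_⟩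
  have h := (hM.rankOneCoeff_coeff (by simpa using hk) (Pi.single (Fin.last d) 1)).2
    (by rw [rankOneCoeff_last]; exact (charpoly_monic _).ne_zero) i hi
  rw [rankOneCoeff_last] at h
  simpa [esig] using h

end SigmaK

/-! ### Smoothness of the symmetric functions and monotonicity of the boundary polynomial. -/

namespace SigmaK

open Polynomial Matrix

section

variable {ι : Type*} [Fintype ι] [DecidableEq ι]

theorem contDiff_esig (k : ℕ) :
    ContDiff ℝ 1 fun M : ι → ι → ℝ => esig k (Matrix.of M) := by
  set p : MvPolynomial (ι × ι) ℝ :=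
    (Matrix.charpoly.univ ℝ ι).coeff (Fintype.card ι - k) with hp
  have h : (fun M : ι → ι → ℝ => esig k (Matrix.of M))
      = (fun x => MvPolynomial.eval x p) ∘ fun M : ι → ι → ℝ => fun q : ι × ι => -M q.1 q.2 := by
    ext M
    have := Matrix.charpoly.univ_coeff_eval₂Hom ι (RingHom.id ℝ) (fun q : ι × ι => -M q.1 q.2)
      (Fintype.card ι - k)
    exact this.symm
  rw [h]
  have h1 : ContDiff ℝ 1 fun x : ι × ι → ℝ => MvPolynomial.eval x p :=
    contDiff_iff_contDiffAt.2 fun x =>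
      (AnalyticOnNhd.eval_mvPolynomial p x (Set.mem_univ x)).contDiffAt
  exact h1.comp (by fun_prop)

/-- Adding t I to N shifts the variable of the characteristic polynomial by t, and Taylor
coefficients are Hasse derivatives. -/
theorem esig_add_smul_one (k : ℕ) (N : Matrix ι ι ℝ) (t : ℝ) :
    esig k (N + t • 1) = (hasseDeriv (Fintype.card ι - k) (-N).charpoly).eval t := by
  have h : -(N + t • 1) = -N - scalar ι t := by
    rw [neg_add, sub_eq_add_neg, smul_one_eq_diagonal]; rfl
  rw [esig, h, charpoly_sub_scalar, ← taylor_apply, taylor_coeff]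

theorem hasDerivAt_esig_add_smul_one {k : ℕ} (hk : k + 1 ≤ Fintype.card ι) (N : Matrix ι ι ℝ)
    (t : ℝ) : HasDerivAt (fun t : ℝ => esig (k + 1) (N + t • 1))
      (((Fintype.card ι : ℝ) - k) * esig k (N + t • 1)) t := by
  simp_rw [esig_add_smul_one]
  obtain ⟨j, hj⟩ := Nat.exists_eq_add_of_le' hk
  have e1 : Fintype.card ι - (k + 1) = j := by omega
  have e2 : Fintype.card ι - k = j + 1 := by omega
  have h := (hasseDeriv j (-N).charpoly).hasDerivAt t
  have h2 : derivative (hasseDeriv j (-N).charpoly) = (j + 1) • hasseDeriv (j + 1) (-N).charpoly := by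
    have := LinearMap.congr_fun (hasseDeriv_comp (R := ℝ) 1 j) (-N).charpoly
    rw [LinearMap.comp_apply, hasseDeriv_one, Nat.choose_one_right, add_comm 1 j] at this
    exact this
  rw [h2] at h
  rw [e1, e2, hj]
  refine h.congr_deriv ?_
  rw [eval_smul, nsmul_eq_mul]
  push_cast
  ring

end

/-- The boundary curvature as a function of the intrinsic tensor `N` and of the normal
derivative `y`. -/
noncomputable def bdryFun {d : ℕ} (l : ℕ) (N : Matrix (Fin d) (Fin d) ℝ) (y : ℝ) : ℝ :=
  -∑ s ∈ Finset.range l, alphaCoeff (d + 1) l s * esig s (N + (-(y ^ 2 / 2)) • 1) *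
    y ^ (2 * l - 2 * s - 1)

theorem alphaCoeff_pos (n l s : ℕ) : 0 < alphaCoeff n l s := by
  rw [alphaCoeff]
  have h1 := Nat.doubleFactorial_pos (2 * l - 2 * s - 1)
  have h2 := Nat.factorial_pos (n - l)
  have h3 := Nat.factorial_pos (n - 1 - s)
  positivity

/-- This recursion is what makes the derivative of `bdryFun` telescope. -/
theorem alphaCoeff_succ {d l s : ℕ} (hs : s + 2 ≤ l) (hl : l ≤ d + 1) :
    alphaCoeff (d + 1) l (s + 1) * ((d : ℝ) - s)
      = alphaCoeff (d + 1) l s * (2 * l - 2 * s - 1 : ℕ) := by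
  obtain ⟨j, rfl⟩ := Nat.exists_eq_add_of_le hs
  obtain ⟨m, rfl⟩ : ∃ m, d = s + 1 + m := Nat.exists_eq_add_of_le (by omega)
  have e1 : s + 1 + m + 1 - 1 - (s + 1) = m := by omega
  have e2 : s + 1 + m + 1 - 1 - s = m + 1 := by omega
  have e3 : 2 * (s + 2 + j) - 2 * (s + 1) - 1 = 2 * j + 1 := by omega
  have e4 : 2 * (s + 2 + j) - 2 * s - 1 = 2 * j + 1 + 2 := by omega
  rw [alphaCoeff, alphaCoeff, e1, e2, e3, e4, Nat.doubleFactorial_add_two, Nat.factorial_succ]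
  have h1 : ((2 * j + 1).doubleFactorial : ℝ) ≠ 0 := by
    exact_mod_cast (Nat.doubleFactorial_pos _).ne'
  have h2 : ((s + 1 + m + 1 - (s + 2 + j)).factorial : ℝ) ≠ 0 := by
    exact_mod_cast (Nat.factorial_pos _).ne'
  have h3 : (2 * (j : ℝ) + 1 + 2) ≠ 0 := by positivity
  push_cast
  field_simp
  ring

theorem alphaCoeff_last (d m : ℕ) : alphaCoeff (d + 1) (m + 1) m = 1 := by
  rw [alphaCoeff, show d + 1 - 1 - m = d - m by omega, show d + 1 - (m + 1) = d - m by omega,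
    show 2 * (m + 1) - 2 * m - 1 = 1 by omega]
  have : ((d - m).factorial : ℝ) ≠ 0 := by exact_mod_cast (Nat.factorial_pos _).ne'
  simp [this]

theorem hasDerivAt_bdryFun {d m : ℕ} (hm : m ≤ d) (N : Matrix (Fin d) (Fin d) ℝ) (y : ℝ) :
    HasDerivAt (bdryFun (m + 1) N) (-esig m (N + (-(y ^ 2 / 2)) • 1)) y := by
  -- The s-th summand has derivative T s - T (s - 1): T s from the power of y, the other from σ_s(N
  -- - y²/2 I) by `alphaCoeff_succ`. Only T m survives the sum.
  set T : ℕ → ℝ := fun s => alphaCoeff (d + 1) (m + 1) s * (2 * (m + 1) - 2 * s - 1 : ℕ)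
    * esig s (N + (-(y ^ 2 / 2)) • 1) * y ^ (2 * (m + 1) - 2 * s - 2) with hT
  have hTm : T m = esig m (N + (-(y ^ 2 / 2)) • 1) := by
    simp only [hT]
    rw [alphaCoeff_last, show 2 * (m + 1) - 2 * m - 1 = 1 by omega,
      show 2 * (m + 1) - 2 * m - 2 = 0 by omega]
    simp
  have hsum : ∑ s ∈ Finset.range (m + 1), (if s = 0 then T 0 else T s - T (s - 1)) = T m := by
    rw [Finset.sum_range_succ']
    have := Finset.sum_range_sub T m
    simp only [Nat.succ_ne_zero, if_false, if_true, Nat.add_sub_cancel]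
    linarith
  rw [← hTm, ← hsum]
  refine HasDerivAt.neg (HasDerivAt.fun_sum fun s hs => ?_)
  have hs' : s < m + 1 := Finset.mem_range.1 hs
  have hp := hasDerivAt_pow (2 * (m + 1) - 2 * s - 1) y
  rcases s with _ | s
  · simp only [esig_zero, mul_one, if_true]
    refine (hp.const_mul (alphaCoeff (d + 1) (m + 1) 0)).congr_deriv ?_
    simp only [hT, esig_zero]
    rw [show 2 * (m + 1) - 2 * 0 - 1 - 1 = 2 * (m + 1) - 2 * 0 - 2 by omega]
    ring
  · rw [if_neg (Nat.succ_ne_zero s)]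
    have hq : HasDerivAt (fun y : ℝ => -(y ^ 2 / 2)) (-y) y := by
      refine ((hasDerivAt_pow 2 y).div_const 2).neg.congr_deriv ?_
      simp
    have he := (hasDerivAt_esig_add_smul_one (k := s) (by simp; omega) N
      (-(y ^ 2 / 2))).comp y hq
    refine ((he.const_mul (alphaCoeff (d + 1) (m + 1) (s + 1))).mul hp).congr_deriv ?_
    simp only [hT, Function.comp, Fintype.card_fin, Nat.add_sub_cancel]
    rw [← alphaCoeff_succ (s := s) (l := m + 1) (by omega) (by omega),
      show 2 * (m + 1) - 2 * (s + 1) - 1 - 1 = 2 * (m + 1) - 2 * (s + 1) - 2 by omega,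
      show 2 * (m + 1) - 2 * s - 2 = 2 * (m + 1) - 2 * (s + 1) - 1 + 1 by omega, pow_succ]
    ring

theorem bdryFun_neg {d l : ℕ} (hl : 1 ≤ l) {N : Matrix (Fin d) (Fin d) ℝ} {y : ℝ} (hy : 0 < y)
    (hN : PosCone (l - 1) (N + (-(y ^ 2 / 2)) • 1)) : bdryFun l N y < 0 := by
  rw [bdryFun, neg_lt_zero]
  refine Finset.sum_pos (fun s hs => ?_) ⟨0, by simp; omega⟩
  have := Finset.mem_range.1 hs
  exact mul_pos (mul_pos (alphaCoeff_pos _ _ _) (hN.2 s (by omega))) (pow_pos hy _)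

/-- The powers of y are odd, so y ≤ 0 and the leading minus sign make the expression nondecreasing
in each σ_s. -/
theorem bdryFun_le_add {d l : ℕ} (hl : l ≤ d + 1) {N D : Matrix (Fin d) (Fin d) ℝ} {y : ℝ}
    (hy : y ≤ 0) (hN : PosCone (l - 1) (N + (-(y ^ 2 / 2)) • 1)) (hD : D.PosSemidef) :
    bdryFun l N y ≤ bdryFun l (N + D) y := by
  rw [bdryFun, bdryFun, neg_le_neg_iff]
  refine Finset.sum_le_sum fun s hs => ?_
  have hs := Finset.mem_range.1 hs
  have h := (hN.add_posSemidef (by simp; omega) hD).2 s (by omega)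
  rw [add_right_comm] at h
  refine mul_le_mul_of_nonpos_right (mul_le_mul_of_nonneg_left h (alphaCoeff_pos _ _ _).le) ?_
  exact Odd.pow_nonpos ⟨l - s - 1, by omega⟩ hy

/-- The y-derivative is -σ_{l-1}(N - y²/2 I). The cone condition at y₁ alone suffices: moving
towards 0 adds a nonnegative multiple of I. -/
theorem bdryFun_antitone {d l : ℕ} (hl1 : 1 ≤ l) (hl : l ≤ d + 1) {N : Matrix (Fin d) (Fin d) ℝ}
    {y₁ y₂ : ℝ} (h12 : y₁ ≤ y₂) (h2 : y₂ ≤ 0)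
    (hN : PosCone (l - 1) (N + (-(y₁ ^ 2 / 2)) • 1)) : bdryFun l N y₂ ≤ bdryFun l N y₁ := by
  obtain ⟨m, rfl⟩ : ∃ m, l = m + 1 := ⟨l - 1, by omega⟩
  have hder := fun y => hasDerivAt_bdryFun (show m ≤ d by omega) N y
  refine antitoneOn_of_hasDerivWithinAt_nonpos (convex_Icc y₁ y₂)
    (fun y _ => (hder y).continuousAt.continuousWithinAt)
    (fun y _ => (hder y).hasDerivWithinAt) (fun y hy => ?_) (Set.left_mem_Icc.2 h12)
    (Set.right_mem_Icc.2 h12) h12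
  rw [interior_Icc] at hy
  have hc : 0 ≤ (y₁ ^ 2 - y ^ 2) / 2 := by nlinarith [hy.1, hy.2]
  have hpsd : (((y₁ ^ 2 - y ^ 2) / 2) • (1 : Matrix (Fin d) (Fin d) ℝ)).PosSemidef :=
    PosSemidef.one.smul hc
  have h := (hN.add_posSemidef (by simp; omega) hpsd).1.2 m (by omega)
  rw [add_assoc, ← add_smul, show -(y₁ ^ 2 / 2) + (y₁ ^ 2 - y ^ 2) / 2 = -(y ^ 2 / 2) by ring] at h
  linarith

end SigmaK

/-! ### The operators as functions of jets, and a direction that decreases both. -/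

namespace SigmaK

open Matrix

theorem hasDerivAt_line {E : Type*} [NormedAddCommGroup E] [NormedSpace ℝ E] {F : E → ℝ}
    (hF : ContDiff ℝ 1 F) (x v : E) (t : ℝ) :
    HasDerivAt (fun s : ℝ => F (x + s • v)) (fderiv ℝ F (x + t • v) v) t := by
  have h1 := (hF.differentiable one_ne_zero (x + t • v)).hasFDerivAt
  have h2 : HasDerivAt (fun s : ℝ => x + s • v) v t := by
    simpa using ((hasDerivAt_id t).smul_const v).const_add x
  exact h1.comp_hasDerivAt t h2

/-- The point is uniformity: one step length r serves all base points and directions near (x, v). -/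
theorem eventually_add_smul_lt {E : Type*} [NormedAddCommGroup E] [NormedSpace ℝ E] {F : E → ℝ}
    (hF : ContDiff ℝ 1 F) {x v : E} (h : fderiv ℝ F x v < 0) :
    ∃ r > 0, ∀ᶠ q : E × E in 𝓝 (x, v), ∀ t ∈ Set.Ioo (0 : ℝ) r, F (q.1 + t • q.2) < F q.1 := by
  have hc : Continuous fun q : (E × E) × ℝ => fderiv ℝ F (q.1.1 + q.2 • q.1.2) q.1.2 :=
    ((hF.continuous_fderiv one_ne_zero).comp (by fun_prop)).clm_apply (by fun_prop)
  have h0 : ∀ᶠ q : (E × E) × ℝ in 𝓝 ((x, v), 0), fderiv ℝ F (q.1.1 + q.2 • q.1.2) q.1.2 < 0 := by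
    apply hc.continuousAt.eventually_lt_const
    simpa using h
  rw [nhds_prod_eq] at h0
  obtain ⟨pa, ha, pb, hb, hab⟩ := Filter.eventually_prod_iff.1 h0
  obtain ⟨r, hr, hball⟩ := Metric.eventually_nhds_iff.1 hb
  refine ⟨r, hr, ha.mono fun q hq t ht => ?_⟩
  have hd : ∀ s ∈ Set.Icc 0 t, fderiv ℝ F (q.1 + s • q.2) q.2 < 0 := fun s hs =>
    hab hq (hball (by rw [Real.dist_0_eq_abs, abs_of_nonneg hs.1]; linarith [hs.2, ht.2]))
  have := strictAntiOn_of_hasDerivWithinAt_neg (convex_Icc 0 t)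
    (fun s _ => (hasDerivAt_line hF q.1 q.2 s).continuousAt.continuousWithinAt)
    (fun s _ => (hasDerivAt_line hF q.1 q.2 s).hasDerivWithinAt)
    (fun s hs => hd s (interior_subset hs)) (Set.left_mem_Icc.2 ht.1.le)
    (Set.right_mem_Icc.2 ht.1.le) ht.1
  simpa using this

theorem eventually_add_smul_mem {E : Type*} [NormedAddCommGroup E] [NormedSpace ℝ E] {P : E → Prop}
    {x : E} (hP : ∀ᶠ y in 𝓝 x, P y) (v : E) :
    ∃ r > 0, ∀ᶠ q : E × E in 𝓝 (x, v), ∀ t ∈ Set.Ioo (0 : ℝ) r, P (q.1 + t • q.2) := by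
  have hc : Continuous fun q : (E × E) × ℝ => q.1.1 + q.2 • q.1.2 := by fun_prop
  have h0 : ∀ᶠ q : (E × E) × ℝ in 𝓝 ((x, v), 0), P (q.1.1 + q.2 • q.1.2) := by
    apply hc.continuousAt.eventually
    simpa using hP
  rw [nhds_prod_eq] at h0
  obtain ⟨pa, ha, pb, hb, hab⟩ := Filter.eventually_prod_iff.1 h0
  obtain ⟨r, hr, hball⟩ := Metric.eventually_nhds_iff.1 hb
  exact ⟨r, hr, ha.mono fun q hq t ht =>
    hab hq (hball (by rw [Real.dist_0_eq_abs, abs_of_nonneg ht.1.le]; exact ht.2))⟩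

/-- The space of values, Hessians and gradients of functions on `Space d`. -/
abbrev Jet (d : ℕ) := ℝ × (Fin (d + 1) → Fin (d + 1) → ℝ) × (Fin (d + 1) → ℝ)

/-- The matrix `-H + g ⊗ g - ½ |g|² I`. -/
noncomputable def schout {d : ℕ} (H : Fin (d + 1) → Fin (d + 1) → ℝ) (g : Fin (d + 1) → ℝ) :
    Matrix (Fin (d + 1)) (Fin (d + 1)) ℝ :=
  Matrix.of fun i j => -H i j + g i * g j - 1 / 2 * (∑ m, g m ^ 2) * (if i = j then 1 else 0)

/-- The matrix `schout` computed from the tangential parts of `H` and `g`. -/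
noncomputable def schoutTang {d : ℕ} (H : Fin (d + 1) → Fin (d + 1) → ℝ) (g : Fin (d + 1) → ℝ) :
    Matrix (Fin d) (Fin d) ℝ :=
  Matrix.of fun i j => -H i.castSucc j.castSucc + g i.castSucc * g j.castSucc
    - 1 / 2 * (∑ m : Fin d, g m.castSucc ^ 2) * (if i = j then 1 else 0)

theorem tangential_schout {d : ℕ} (H : Fin (d + 1) → Fin (d + 1) → ℝ) (g : Fin (d + 1) → ℝ) :
    tangential (schout H g) = schoutTang H g + (-(g (Fin.last d) ^ 2 / 2)) • 1 := by
  ext i j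
  simp only [tangential, schout, schoutTang, submatrix_apply, of_apply, Fin.sum_univ_castSucc,
    Fin.castSucc_inj, Matrix.add_apply, Matrix.smul_apply, one_apply, smul_eq_mul]
  split_ifs <;> ring

/-- The interior operator `e^{pw} σ_k(A[w])` as a function of the jet of `w`. -/
noncomputable def interiorOp {d : ℕ} (p : ℝ) (k : ℕ) (j : Jet d) : ℝ :=
  Real.exp ((p - 2 * k) * j.1) * esig k (schout j.2.1 j.2.2)

/-- The boundary operator `𝓑^l[w]` as a function of the jet of `w`. -/
noncomputable def boundaryOp {d : ℕ} (l : ℕ) (j : Jet d) : ℝ :=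
  Real.exp (-(2 * l - 1) * j.1) * bdryFun l (schoutTang j.2.1 j.2.2) (j.2.2 (Fin.last d))

theorem contDiff_interiorOp {d : ℕ} (p : ℝ) (k : ℕ) :
    ContDiff ℝ 1 (interiorOp p k : Jet d → ℝ) := by
  have h : ContDiff ℝ 1 fun j : Jet d => esig k (schout j.2.1 j.2.2) :=
    (contDiff_esig k).comp (g := fun M : Fin (d + 1) → Fin (d + 1) → ℝ => esig k (Matrix.of M))
      (f := fun j : Jet d => fun i i' => -j.2.1 i i' + j.2.2 i * j.2.2 i'
        - 1 / 2 * (∑ m, j.2.2 m ^ 2) * (if i = i' then 1 else 0)) (by fun_prop)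
  unfold interiorOp
  fun_prop

theorem contDiff_esig_schoutTang {d : ℕ} (s : ℕ) :
    ContDiff ℝ 1 fun j : Jet d =>
      esig s (schoutTang j.2.1 j.2.2 + (-(j.2.2 (Fin.last d) ^ 2 / 2)) • 1) := by
  have h := (contDiff_esig s).comp
    (g := fun M : Fin d → Fin d → ℝ => esig s (Matrix.of M))
    (f := fun j : Jet d => fun i i' : Fin d => -j.2.1 i.castSucc i'.castSucc
      + j.2.2 i.castSucc * j.2.2 i'.castSucc
      - 1 / 2 * (∑ m : Fin d, j.2.2 m.castSucc ^ 2) * (if i = i' then 1 else 0)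
      + (-(j.2.2 (Fin.last d) ^ 2 / 2)) * (if i = i' then 1 else 0)) (by fun_prop)
  convert! h using 2 with j

theorem contDiff_boundaryOp {d : ℕ} (l : ℕ) :
    ContDiff ℝ 1 (boundaryOp l : Jet d → ℝ) := by
  have h := fun s => contDiff_esig_schoutTang (d := d) s
  unfold boundaryOp bdryFun
  fun_prop

/-- The matrix whose only nonzero entry is the one in the last row and column. -/
noncomputable def lastEntry (d : ℕ) : Fin (d + 1) → Fin (d + 1) → ℝ :=
  fun i j => if i = Fin.last d ∧ j = Fin.last d then 1 else 0

/-- The boundary operator involves only the tangential block of the Hessian. -/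
theorem fderiv_boundaryOp_lastEntry {d : ℕ} (l : ℕ) (j : Jet d) :
    fderiv ℝ (boundaryOp l) j (0, lastEntry d, 0) = 0 := by
  have h := hasDerivAt_line (contDiff_boundaryOp l) j (0, lastEntry d, 0) 0
  rw [zero_smul, add_zero] at h
  refine h.unique ?_
  have : (fun s : ℝ => boundaryOp l (j + s • ((0, lastEntry d, 0) : Jet d)))
      = fun _ => boundaryOp l j := by
    ext s
    simp [boundaryOp, schoutTang, lastEntry, Fin.castSucc_ne_last]
  rw [this]
  exact hasDerivAt_const _ _

theorem fderiv_boundaryOp_normal {d m : ℕ} (hm : m ≤ d) (j : Jet d) :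
    fderiv ℝ (boundaryOp (m + 1)) j (0, 0, Pi.single (Fin.last d) 1)
      = -(Real.exp (-(2 * (m + 1 : ℕ) - 1) * j.1) * esig m (tangential (schout j.2.1 j.2.2))) := by
  have h := hasDerivAt_line (contDiff_boundaryOp (m + 1)) j (0, 0, Pi.single (Fin.last d) 1) 0
  rw [zero_smul, add_zero] at h
  refine h.unique ?_
  have : (fun s : ℝ => boundaryOp (m + 1) (j + s • ((0, 0, Pi.single (Fin.last d) 1) : Jet d)))
      = fun s => Real.exp (-(2 * (m + 1 : ℕ) - 1) * j.1) *
        bdryFun (m + 1) (schoutTang j.2.1 j.2.2) (j.2.2 (Fin.last d) + s) := by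
    ext s
    simp [boundaryOp, schoutTang, Fin.castSucc_ne_last]
  rw [this, tangential_schout]
  have h2 := hasDerivAt_bdryFun hm (schoutTang j.2.1 j.2.2) (j.2.2 (Fin.last d) + 0)
  have h3 := (h2.comp_const_add (j.2.2 (Fin.last d)) 0).const_mul
    (Real.exp (-(2 * (m + 1 : ℕ) - 1) * j.1))
  refine h3.congr_deriv ?_
  rw [add_zero]
  ring

theorem fderiv_interiorOp_lastEntry {d : ℕ} (p : ℝ) (k : ℕ) (j : Jet d) :
    fderiv ℝ (interiorOp p (k + 1)) j (0, lastEntry d, 0)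
      = -(Real.exp ((p - 2 * (k + 1 : ℕ)) * j.1) *
        esig k (tangential (schout j.2.1 j.2.2))) := by
  have h := hasDerivAt_line (contDiff_interiorOp p (k + 1)) j (0, lastEntry d, 0) 0
  rw [zero_smul, add_zero] at h
  refine h.unique ?_
  set E := Real.exp ((p - 2 * (k + 1 : ℕ)) * j.1)
  have : (fun s : ℝ => interiorOp p (k + 1) (j + s • ((0, lastEntry d, 0) : Jet d)))
      = fun s => E * (esig (k + 1) (schout j.2.1 j.2.2)
        + (-s) * esig k (tangential (schout j.2.1 j.2.2))) := by
    ext s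
    have e : schout (j + s • ((0, lastEntry d, 0) : Jet d)).2.1
        (j + s • ((0, lastEntry d, 0) : Jet d)).2.2 = schout j.2.1 j.2.2
          + (-s) • vecMulVec (Pi.single (Fin.last d) 1) (Pi.single (Fin.last d) 1) := by
      ext a b
      by_cases ha : a = Fin.last d <;> by_cases hb : b = Fin.last d <;>
        simp [schout, lastEntry, vecMulVec_apply, ha, hb]
      ring
    rw [← esig_succ_add_last, ← e]
    simp [interiorOp, E]
  rw [this]
  refine ((((hasDerivAt_id (0 : ℝ)).neg.mul_const _).const_add _).const_mul E).congr_deriv ?_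
  ring

/-- The Hessian of `x ↦ -|x|² + M x_n²`. -/
noncomputable def barrierHess (d : ℕ) (M : ℝ) : Fin (d + 1) → Fin (d + 1) → ℝ :=
  fun i j => (if i = j then -2 else 0) + 2 * M * lastEntry d i j

theorem exists_barrier_direction {d k l : ℕ} (hl : 1 ≤ l) (hlk : l ≤ k) (hk : k ≤ d + 1) (p : ℝ)
    {j : Jet d} (hj : PosCone k (schout j.2.1 j.2.2)) :
    ∃ μ M : ℝ, fderiv ℝ (interiorOp p k) j
        (0, barrierHess d M, μ • Pi.single (Fin.last d) 1) < 0 ∧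
      fderiv ℝ (boundaryOp l) j (0, barrierHess d M, μ • Pi.single (Fin.last d) 1) < 0 := by
  obtain ⟨l, rfl⟩ : ∃ m, l = m + 1 := ⟨l - 1, by omega⟩
  obtain ⟨k, rfl⟩ : ∃ m, k = m + 1 := ⟨k - 1, by omega⟩
  have hT := hj.tangential (by omega)
  have hdec : ∀ μ M : ℝ, ((0, barrierHess d M, μ • Pi.single (Fin.last d) 1) : Jet d)
      = (0, barrierHess d 0, 0) + (2 * M) • (0, lastEntry d, 0)
        + μ • (0, 0, Pi.single (Fin.last d) 1) := by
    intro μ M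
    ext <;> simp [barrierHess]
  have key : ∀ a b : ℝ, 0 < b → ∃ t : ℝ, a + t * (-b) < 0 := fun a b hb =>
    ⟨(a + 1) / b, by field_simp; linarith⟩
  -- First μ, for the boundary operator, which is blind to M; then M, for the interior operator with
  -- μ fixed.
  obtain ⟨μ, hμ⟩ := key (fderiv ℝ (boundaryOp (l + 1)) j (0, barrierHess d 0, 0)) _
    (mul_pos (Real.exp_pos (-(2 * (l + 1 : ℕ) - 1) * j.1)) (hT.2 l (by omega)))
  obtain ⟨M, hM⟩ := key (fderiv ℝ (interiorOp p (k + 1)) j (0, barrierHess d 0, 0)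
      + μ * fderiv ℝ (interiorOp p (k + 1)) j (0, 0, Pi.single (Fin.last d) 1)) _
    (mul_pos (Real.exp_pos ((p - 2 * (k + 1 : ℕ)) * j.1)) (hT.2 k le_rfl))
  -- Halved because the Hessian of M x_n² is 2M in the last entry.
  refine ⟨μ, M / 2, ?_, ?_⟩
  · rw [hdec, map_add, map_add, map_smul, map_smul, fderiv_interiorOp_lastEntry, smul_eq_mul,
      smul_eq_mul]
    linarith
  · rw [hdec, map_add, map_add, map_smul, map_smul, fderiv_boundaryOp_lastEntry,
      fderiv_boundaryOp_normal (by omega), smul_eq_mul, smul_eq_mul]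
    linarith

end SigmaK

/-! ### From the conformal Hessian to jets, and derivatives along lines. -/

namespace SigmaK

open Matrix

/-- Substituting cX into the characteristic polynomial of -cM produces the factor c^n; compare
coefficients. -/
theorem esig_smul {ι : Type*} [Fintype ι] [DecidableEq ι] {k : ℕ} (hk : k ≤ Fintype.card ι)
    {c : ℝ} (hc : c ≠ 0) (M : Matrix ι ι ℝ) : esig k (c • M) = c ^ k * esig k M := by
  have h : (-(c • M)).charpoly.comp (Polynomial.C c * Polynomial.X)
      = Polynomial.C (c ^ Fintype.card ι) * (-M).charpoly := by
    apply Polynomial.funext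
    intro x
    rw [Polynomial.eval_comp, Polynomial.eval_mul, Polynomial.eval_mul, Polynomial.eval_C,
      Polynomial.eval_X, Polynomial.eval_C, eval_charpoly, eval_charpoly, ← det_smul, smul_sub,
      smul_neg]
    congr 2
    ext i j
    simp [scalar_apply, diagonal_apply]
  have h2 := congrArg (fun q => q.coeff (Fintype.card ι - k)) h
  simp only [Polynomial.comp_C_mul_X_coeff, Polynomial.coeff_C_mul] at h2
  change esig k (c • M) * c ^ (Fintype.card ι - k) = c ^ Fintype.card ι * esig k M at h2
  have h3 : c ^ Fintype.card ι = c ^ k * c ^ (Fintype.card ι - k) := by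
    rw [← pow_add, Nat.add_sub_cancel' hk]
  rw [h3] at h2
  apply mul_right_cancel₀ (pow_ne_zero (Fintype.card ι - k) hc)
  linarith

theorem PosCone.smul {ι : Type*} [Fintype ι] [DecidableEq ι] {k : ℕ} (hk : k ≤ Fintype.card ι)
    {c : ℝ} (hc : 0 < c) {M : Matrix ι ι ℝ} (hM : PosCone k M) : PosCone k (c • M) := by
  refine ⟨?_, fun i hi => ?_⟩
  · have := hM.1
    rw [IsHermitian, conjTranspose_eq_transpose_of_trivial] at this ⊢
    rw [transpose_smul, this]
  · rw [esig_smul (hi.trans hk) hc.ne']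
    exact mul_pos (pow_pos hc i) (hM.2 i hi)

theorem posCone_of_mem_Gam {ι : Type*} [Fintype ι] [DecidableEq ι] {k : ℕ}
    (hk : k ≤ Fintype.card ι) {M : Matrix ι ι ℝ} (hM : M ∈ Gam k) : PosCone k M := by
  refine ⟨?_, fun i hi => ?_⟩
  · rw [IsHermitian, conjTranspose_eq_transpose_of_trivial]; exact hM.1
  · rcases Nat.eq_zero_or_pos i with rfl | h
    · rw [esig_zero]; exact one_pos
    · rw [← sigma_eq_esig hM.1 (hi.trans hk)]; exact hM.2 i h hi

/-- Value, Hessian and gradient of `w` at `x`. -/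
noncomputable def jetOf {d : ℕ} (S : Set (Space d)) (w : Space d → ℝ) (x : Space d) : Jet d :=
  (w x, fun i j => partialDeriv S (partialDeriv S w j) i x, fun i => partialDeriv S w i x)

theorem confHess_eq_smul {d : ℕ} (S : Set (Space d)) (w : Space d → ℝ) (x : Space d) :
    confHess S w x
      = Real.exp (-2 * w x) • schout (jetOf S w x).2.1 (jetOf S w x).2.2 := by
  ext i j
  rfl

section

variable {d : ℕ} {S : Set (Space d)} {w : Space d → ℝ} {x : Space d}

theorem posCone_schout {k : ℕ} (hk : k ≤ d + 1) (h : confHess S w x ∈ Gam k) :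
    PosCone k (schout (jetOf S w x).2.1 (jetOf S w x).2.2) := by
  have h2 := (posCone_of_mem_Gam (by simpa using hk) h).smul (by simpa using hk)
    (Real.exp_pos (2 * w x))
  rwa [confHess_eq_smul, smul_smul, ← Real.exp_add, show 2 * w x + -2 * w x = 0 by ring,
    Real.exp_zero, one_smul] at h2

theorem exp_mul_sigma_confHess {k : ℕ} (hk : k ≤ d + 1) (h : confHess S w x ∈ Gam k) (p : ℝ) :
    Real.exp (p * w x) * sigma k (confHess S w x) = interiorOp p k (jetOf S w x) := by
  rw [sigma_eq_esig h.1 (by simpa using hk), confHess_eq_smul,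
    esig_smul (by simpa using hk) (Real.exp_pos _).ne', ← mul_assoc, ← Real.exp_nat_mul,
    ← Real.exp_add, interiorOp]
  congr 2
  simp only [jetOf]
  ring

theorem boundaryB_eq_boundaryOp {l : ℕ} (hl : l ≤ d + 1) (h : (confHess S w x).IsSymm) :
    boundaryB S l w x = boundaryOp l (jetOf S w x) := by
  rw [boundaryB, boundaryOp, bdryFun, mul_neg, Finset.mul_sum]
  congr 1
  refine Finset.sum_congr rfl fun s hs => ?_
  have hs := Finset.mem_range.1 hs
  have hsym : (tangential (confHess S w x)).IsSymm := h.submatrix _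
  have e : tangential (confHess S w x) = Real.exp (-2 * w x) •
      (schoutTang (jetOf S w x).2.1 (jetOf S w x).2.2
        + (-((jetOf S w x).2.2 (Fin.last d) ^ 2 / 2)) • 1) := by
    rw [← tangential_schout, confHess_eq_smul]
    rfl
  rw [sigma_eq_esig hsym (by simp; omega), e, esig_smul (by simp; omega) (Real.exp_pos _).ne',
    mul_pow, ← Real.exp_nat_mul, ← Real.exp_nat_mul]
  -- Every summand carries the same weight: 2s from σ_s and 2l-2s-1 from the normal derivative add
  -- up to 2l-1.
  have e2 : Real.exp (-(2 * l - 1) * (jetOf S w x).1)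
      = Real.exp (s * (-2 * w x)) * Real.exp (((2 * l - 2 * s - 1 : ℕ) : ℝ) * -w x) := by
    rw [← Real.exp_add]
    congr 1
    rw [Nat.sub_sub, Nat.cast_sub (by omega)]
    simp only [jetOf]
    push_cast
    ring
  rw [e2]
  simp only [jetOf]
  ring

theorem contDiffOn_partialDeriv (hS : UniqueDiffOn ℝ S) (hw : ContDiffOn ℝ 2 w S)
    (i : Fin (d + 1)) : ContDiffOn ℝ 1 (partialDeriv S w i) S :=
  (hw.fderivWithin (m := 1) hS (by norm_num)).clm_apply contDiffOn_const

theorem continuousOn_partialDeriv (hS : UniqueDiffOn ℝ S) (hw : ContDiffOn ℝ 1 w S)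
    (i : Fin (d + 1)) : ContinuousOn (partialDeriv S w i) S :=
  (hw.continuousOn_fderivWithin hS le_rfl).clm_apply continuousOn_const

theorem continuousOn_jetOf (hS : UniqueDiffOn ℝ S) (hw : ContDiffOn ℝ 2 w S) :
    ContinuousOn (jetOf S w) S := by
  refine hw.continuousOn.prodMk (ContinuousOn.prodMk ?_ ?_)
  · exact continuousOn_pi.2 fun i => continuousOn_pi.2 fun j =>
      continuousOn_partialDeriv hS (contDiffOn_partialDeriv hS hw j) i
  · exact continuousOn_pi.2 fun i =>
      continuousOn_partialDeriv hS (hw.of_le (by norm_num)) i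

theorem fderivWithin_eq_sum (ξ : Space d) :
    fderivWithin ℝ w S x ξ = ∑ i, ξ i * partialDeriv S w i x := by
  have h : ξ = ∑ i, ξ i • EuclideanSpace.single i (1 : ℝ) := by
    ext j
    simp [Finset.sum_apply, Pi.single_apply]
  conv_lhs => rw [h]
  simp [partialDeriv]

theorem hasDerivWithinAt_line (hw : DifferentiableOn ℝ w S) {ξ : Space d} {t : ℝ} {T : Set ℝ}
    (ht : x + t • ξ ∈ S) (hT : ∀ s ∈ T, x + s • ξ ∈ S) :
    HasDerivWithinAt (fun s : ℝ => w (x + s • ξ)) (∑ i, ξ i * partialDeriv S w i (x + t • ξ)) T t := by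
  rw [← fderivWithin_eq_sum]
  have h1 : HasDerivWithinAt (fun s : ℝ => x + s • ξ) ξ T t := by
    simpa using (((hasDerivAt_id t).smul_const ξ).const_add x).hasDerivWithinAt
  exact (hw _ ht).hasFDerivWithinAt.comp_hasDerivWithinAt t h1 hT

theorem hasDerivAt_line_of_eventually (hw : DifferentiableOn ℝ w S) {ξ : Space d} {t : ℝ}
    (hT : ∀ᶠ s in 𝓝 t, x + s • ξ ∈ S) :
    HasDerivAt (fun s : ℝ => w (x + s • ξ)) (∑ i, ξ i * partialDeriv S w i (x + t • ξ)) t :=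
  (hasDerivWithinAt_line hw hT.self_of_nhds (T := {s | x + s • ξ ∈ S}) fun _ hs => hs).hasDerivAt hT

/-- The second derivative of `w` in the direction `ξ`. -/
theorem hasDerivAt_line_deriv (hS : UniqueDiffOn ℝ S) (hw : ContDiffOn ℝ 2 w S) {ξ : Space d}
    (hT : ∀ᶠ s in 𝓝 (0 : ℝ), x + s • ξ ∈ S) :
    HasDerivAt (fun s : ℝ => ∑ i, ξ i * partialDeriv S w i (x + s • ξ))
      (∑ i, ξ i * ∑ j, ξ j * partialDeriv S (partialDeriv S w i) j x) 0 := by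
  refine HasDerivAt.fun_sum fun i _ => HasDerivAt.const_mul _ ?_
  have := hasDerivAt_line_of_eventually
    ((contDiffOn_partialDeriv hS hw i).differentiableOn one_ne_zero) hT
  simpa using this

end

/-- A negative second derivative would make the point a local maximum too, so f would be locally
constant with second derivative 0. -/
theorem IsLocalMin.second_deriv_nonneg {f f' : ℝ → ℝ} {f'' x : ℝ} (h : IsLocalMin f x)
    (hf : ∀ᶠ t in 𝓝 x, HasDerivAt f (f' t) t) (hf' : HasDerivAt f' f'' x) : 0 ≤ f'' := by
  by_contra! hneg
  have h1 : f' =ᶠ[𝓝 x] deriv f := hf.mono fun t ht => ht.deriv.symm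
  have h2 : deriv (deriv f) x = f'' := (hf'.congr_of_eventuallyEq h1.symm).deriv
  have h3 : deriv f x = 0 := h.deriv_eq_zero
  have h4 : IsLocalMax f x :=
    isLocalMax_of_deriv_deriv_neg (by rw [h2]; exact hneg) h3 hf.self_of_nhds.continuousAt
  have h5 : f =ᶠ[𝓝 x] fun _ => f x := by
    filter_upwards [h, h4] with t ht ht' using le_antisymm ht' ht
  have h6 : deriv (deriv f) x = 0 := by
    rw [h5.deriv.deriv_eq]
    simp
  rw [h2] at h6
  exact hneg.ne h6

/-- If a `C²` function is touched from below along a line, its first derivatives agree with those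
of the touching function, and its second derivative is not smaller. -/
theorem line_touch {d : ℕ} {S : Set (Space d)} {w : Space d → ℝ} {x : Space d}
    (hS : UniqueDiffOn ℝ S) (hw : ContDiffOn ℝ 2 w S) {ξ : Space d}
    (hT : ∀ᶠ s in 𝓝 (0 : ℝ), x + s • ξ ∈ S) {q q' : ℝ → ℝ} {q'' : ℝ}
    (hq : ∀ᶠ t in 𝓝 (0 : ℝ), HasDerivAt q (q' t) t) (hq' : HasDerivAt q' q'' 0)
    (hmin : ∀ᶠ t in 𝓝 (0 : ℝ), w x - q 0 ≤ w (x + t • ξ) - q t) :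
    ∑ i, ξ i * partialDeriv S w i x = q' 0 ∧
      q'' ≤ ∑ i, ξ i * ∑ j, ξ j * partialDeriv S (partialDeriv S w i) j x := by
  have h1 : ∀ᶠ t in 𝓝 (0 : ℝ), HasDerivAt (fun t => w (x + t • ξ) - q t)
      (∑ i, ξ i * partialDeriv S w i (x + t • ξ) - q' t) t := by
    filter_upwards [hT.eventually_nhds, hq] with t ht hqt
    exact (hasDerivAt_line_of_eventually (hw.differentiableOn two_ne_zero) ht).sub hqt
  have h2 := (hasDerivAt_line_deriv hS hw hT).sub hq'
  have hm : IsLocalMin (fun t : ℝ => w (x + t • ξ) - q t) 0 := by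
    filter_upwards [hmin] with t ht
    simpa using ht
  constructor
  · have := hm.hasDerivAt_eq_zero h1.self_of_nhds
    simpa using sub_eq_zero.1 this
  · have := IsLocalMin.second_deriv_nonneg hm h1 h2
    linarith

end SigmaK

/-! ### Geometry of the half ball, existence of minima and radial barriers. -/

namespace SigmaK

open Matrix

/-- The closed half ball without its centre. -/
abbrev puncturedHalfBall (d : ℕ) : Set (Space d) := closedHalfBall d \ {0}

theorem isOpen_halfBall (d : ℕ) : IsOpen (halfBall d) :=
  (isOpen_lt continuous_norm continuous_const).inter
    (isOpen_lt continuous_const (by fun_prop : Continuous fun y : Space d => y (Fin.last d)))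

theorem isClosed_closedHalfBall (d : ℕ) : IsClosed (closedHalfBall d) := by
  rw [← closure_halfBall]; exact isClosed_closure

theorem halfBall_subset (d : ℕ) : halfBall d ⊆ puncturedHalfBall d := by
  rintro x ⟨h1, h2⟩
  refine ⟨⟨h1.le, h2.le⟩, ?_⟩
  rintro rfl
  simp at h2

theorem flatBoundary_subset (d : ℕ) : flatBoundary d \ {0} ⊆ puncturedHalfBall d :=
  fun _ hx => ⟨⟨hx.1.1.le, hx.1.2.ge⟩, hx.2⟩

theorem convex_closedHalfBall (d : ℕ) : Convex ℝ (closedHalfBall d) := by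
  intro x hx y hy a b ha hb hab
  refine ⟨?_, ?_⟩
  · calc ‖a • x + b • y‖ ≤ ‖a • x‖ + ‖b • y‖ := norm_add_le _ _
      _ = a * ‖x‖ + b * ‖y‖ := by
        rw [norm_smul, norm_smul, Real.norm_of_nonneg ha, Real.norm_of_nonneg hb]
      _ ≤ 1 := by nlinarith [hx.1, hy.1]
  · simp only [PiLp.add_apply, PiLp.smul_apply, smul_eq_mul]
    exact add_nonneg (mul_nonneg ha hx.2) (mul_nonneg hb hy.2)

theorem uniqueDiffOn_closedHalfBall (d : ℕ) : UniqueDiffOn ℝ (closedHalfBall d) := by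
  refine uniqueDiffOn_convex (convex_closedHalfBall d) ⟨EuclideanSpace.single (Fin.last d) (1 / 2), ?_⟩
  refine mem_interior.2 ⟨halfBall d, fun x hx => (halfBall_subset d hx).1, isOpen_halfBall d, ?_, ?_⟩
  · simp; norm_num
  · simp

theorem uniqueDiffOn_puncturedHalfBall (d : ℕ) : UniqueDiffOn ℝ (puncturedHalfBall d) :=
  (uniqueDiffOn_closedHalfBall d).inter isOpen_compl_singleton

theorem eventually_line_mem_of_halfBall {d : ℕ} {x : Space d} (hx : x ∈ halfBall d) (ξ : Space d) :
    ∀ᶠ t in 𝓝 (0 : ℝ), x + t • ξ ∈ halfBall d := by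
  have hc : Continuous fun t : ℝ => x + t • ξ := by fun_prop
  exact hc.continuousAt.eventually_mem ((isOpen_halfBall d).mem_nhds (by simpa using hx))

theorem eventually_line_mem_of_flat {d : ℕ} {x : Space d} (hx : x ∈ flatBoundary d \ {0})
    {ξ : Space d} (hξ : ξ (Fin.last d) = 0) :
    ∀ᶠ t in 𝓝 (0 : ℝ), x + t • ξ ∈ puncturedHalfBall d := by
  have hc : Continuous fun t : ℝ => x + t • ξ := by fun_prop
  have h1 : ∀ᶠ t in 𝓝 (0 : ℝ), ‖x + t • ξ‖ < 1 :=
    (hc.norm).continuousAt.eventually_lt_const (by simpa using hx.1.1)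
  have h2 : ∀ᶠ t in 𝓝 (0 : ℝ), x + t • ξ ≠ 0 := by
    apply hc.continuousAt.eventually_ne
    simpa using hx.2
  filter_upwards [h1, h2] with t ht1 ht2
  refine ⟨⟨ht1.le, ?_⟩, ht2⟩
  simp [hξ, hx.1.2]

theorem eventually_line_mem_normal {d : ℕ} {x : Space d} (hx : x ∈ flatBoundary d \ {0}) :
    ∀ᶠ t in 𝓝[≥] (0 : ℝ), x + t • EuclideanSpace.single (Fin.last d) (1 : ℝ) ∈
      puncturedHalfBall d := by
  have hc : Continuous fun t : ℝ => x + t • EuclideanSpace.single (Fin.last d) (1 : ℝ) := by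
    fun_prop
  have h1 : ∀ᶠ t in 𝓝 (0 : ℝ), ‖x + t • EuclideanSpace.single (Fin.last d) (1 : ℝ)‖ < 1 :=
    (hc.norm).continuousAt.eventually_lt_const (by simpa using hx.1.1)
  have h2 : ∀ᶠ t in 𝓝 (0 : ℝ), x + t • EuclideanSpace.single (Fin.last d) (1 : ℝ) ≠ 0 := by
    apply hc.continuousAt.eventually_ne
    simpa using hx.2
  filter_upwards [nhdsWithin_le_nhds h1, nhdsWithin_le_nhds h2, self_mem_nhdsWithin]
    with t ht1 ht2 ht3
  refine ⟨⟨ht1.le, ?_⟩, ht2⟩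
  simpa [hx.1.2] using ht3

theorem hasDerivWithinAt_normal {d : ℕ} {w : Space d → ℝ} {x : Space d}
    (hw : DifferentiableOn ℝ w (puncturedHalfBall d)) (hx : x ∈ flatBoundary d \ {0}) :
    HasDerivWithinAt (fun s : ℝ => w (x + s • EuclideanSpace.single (Fin.last d) (1 : ℝ)))
      (partialDeriv (puncturedHalfBall d) w (Fin.last d) x) (Set.Ici 0) 0 := by
  set e : Space d := EuclideanSpace.single (Fin.last d) (1 : ℝ) with he
  set T : Set ℝ := {t | x + t • e ∈ puncturedHalfBall d} with hT
  have h1 := hasDerivWithinAt_line hw (ξ := e) (t := 0) (T := T)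
    (by simpa using flatBoundary_subset d hx) fun _ hs => hs
  rw [← fderivWithin_eq_sum, zero_smul, add_zero] at h1
  exact h1.mono_of_mem_nhdsWithin (eventually_line_mem_normal hx)

/-- At a flat boundary point only inward displacements are available, so contact gives an inequality
of normal derivatives, not equality. -/
theorem normal_touch {d : ℕ} {w : Space d → ℝ} {x : Space d}
    (hw : DifferentiableOn ℝ w (puncturedHalfBall d)) (hx : x ∈ flatBoundary d \ {0})
    {q : ℝ → ℝ} {q' : ℝ} (hq : HasDerivWithinAt q q' (Set.Ici 0) 0)
    (hmin : ∀ᶠ t in 𝓝[≥] (0 : ℝ),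
      w x - q 0 ≤ w (x + t • EuclideanSpace.single (Fin.last d) (1 : ℝ)) - q t) :
    q' ≤ partialDeriv (puncturedHalfBall d) w (Fin.last d) x := by
  have h3 := ((hasDerivWithinAt_normal hw hx).sub hq).mono (Set.Ioi_subset_Ici_self)
  rw [hasDerivWithinAt_iff_tendsto_slope' (by simp)] at h3
  have h4 := ge_of_tendsto (b := 0) h3 ?_
  · linarith
  · filter_upwards [nhdsWithin_mono _ Set.Ioi_subset_Ici_self hmin, self_mem_nhdsWithin]
      with t ht ht0
    rw [slope_def_field]
    apply div_nonneg _ (by simpa using (Set.mem_Ioi.1 ht0).le)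
    simp only [Pi.sub_apply, zero_smul, add_zero]
    linarith

/-- A continuous function on the punctured half ball of radius `R` which is larger near the origin
than somewhere else attains its minimum. -/
theorem exists_min_of_lt_near_zero {d : ℕ} {R : ℝ} {f : Space d → ℝ}
    (hf : ContinuousOn f (puncturedHalfBall d)) {y : Space d} (hy : y ∈ puncturedHalfBall d)
    (hyR : ‖y‖ ≤ R) (hnear : ∃ ρ > 0, ∀ x ∈ puncturedHalfBall d, ‖x‖ < ρ → f y < f x) :
    ∃ x ∈ puncturedHalfBall d, ‖x‖ ≤ R ∧ f x ≤ f y ∧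
      ∀ z ∈ puncturedHalfBall d, ‖z‖ ≤ R → f x ≤ f z := by
  obtain ⟨ρ, hρ, hnear⟩ := hnear
  set K : Set (Space d) := (closedHalfBall d ∩ {x | ‖x‖ ≤ R}) ∩ {x | ρ ≤ ‖x‖} with hK
  have hKS : K ⊆ puncturedHalfBall d := by
    rintro x ⟨⟨h1, -⟩, h3⟩
    refine ⟨h1, ?_⟩
    rintro rfl
    simp only [Set.mem_ofPred_eq, norm_zero] at h3
    linarith
  have hKc : IsCompact K := by
    apply Metric.isCompact_of_isClosed_isBounded
    · exact ((isClosed_closedHalfBall d).inter (isClosed_le continuous_norm continuous_const)).inter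
        (isClosed_le continuous_const continuous_norm)
    · exact (Metric.isBounded_closedBall (x := (0 : Space d)) (r := R)).subset fun x hx => by
        simpa using hx.1.2
  have hyK : y ∈ K := ⟨⟨hy.1, hyR⟩, by
    by_contra h
    exact lt_irrefl _ (hnear y hy (not_le.1 h))⟩
  obtain ⟨x, hxK, hx⟩ := hKc.exists_isMinOn ⟨y, hyK⟩ (hf.mono hKS)
  refine ⟨x, hKS hxK, hxK.1.2, hx hyK, fun z hz hzR => ?_⟩
  by_cases h : ρ ≤ ‖z‖
  · exact hx ⟨⟨hz.1, hzR⟩, h⟩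
  · exact (hx hyK).trans (hnear z hz (not_le.1 h)).le

/-- The Laplacian. -/
noncomputable def laplacian {d : ℕ} (S : Set (Space d)) (w : Space d → ℝ) (x : Space d) : ℝ :=
  ∑ i, partialDeriv S (partialDeriv S w i) i x

/-- The functions `⟨b, x⟩ + F(|x|²) + x_n G(|x|²)`. -/
noncomputable def radialBarrier {d : ℕ} (b : Fin (d + 1) → ℝ) (F G : ℝ → ℝ) (x : Space d) : ℝ :=
  ∑ i, b i * x i + F (‖x‖ ^ 2) + x (Fin.last d) * G (‖x‖ ^ 2)

theorem norm_sq_add_smul_single {d : ℕ} (x : Space d) (i : Fin (d + 1)) (t : ℝ) :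
    ‖x + t • EuclideanSpace.single i (1 : ℝ)‖ ^ 2 = ‖x‖ ^ 2 + 2 * t * x i + t ^ 2 := by
  rw [norm_add_sq_real, inner_smul_right, EuclideanSpace.inner_single_right, norm_smul]
  simp
  ring

theorem radialBarrier_add_smul_single {d : ℕ} (b : Fin (d + 1) → ℝ) (F G : ℝ → ℝ) (x : Space d)
    (i : Fin (d + 1)) (t : ℝ) :
    radialBarrier b F G (x + t • EuclideanSpace.single i (1 : ℝ))
      = ∑ j, b j * x j + t * b i + F (‖x‖ ^ 2 + 2 * t * x i + t ^ 2)
        + (x (Fin.last d) + t * (if i = Fin.last d then 1 else 0))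
          * G (‖x‖ ^ 2 + 2 * t * x i + t ^ 2) := by
  rw [radialBarrier, norm_sq_add_smul_single]
  congr 2
  · simp only [PiLp.add_apply, PiLp.smul_apply, smul_eq_mul, mul_add, Finset.sum_add_distrib,
      PiLp.single_apply, mul_ite, mul_one, mul_zero, Finset.sum_ite_eq', Finset.mem_univ,
      if_true]
    simp [mul_comm]
  · simp [eq_comm]

/-- The left side is the Laplacian of the barrier at x; the extra 4 G' is the cross term 2 ∂G/∂x_n.
The second-derivative test is applied in each coordinate direction and summed. -/
theorem laplacian_ge_of_touch {d : ℕ} {w : Space d → ℝ}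
    (hw : ContDiffOn ℝ 2 w (puncturedHalfBall d)) {x : Space d} (hx : x ∈ halfBall d)
    {b : Fin (d + 1) → ℝ} {F F' G G' : ℝ → ℝ} {F'' G'' : ℝ}
    (hF : ∀ s, 0 < s → HasDerivAt F (F' s) s) (hG : ∀ s, 0 < s → HasDerivAt G (G' s) s)
    (hF' : HasDerivAt F' F'' (‖x‖ ^ 2)) (hG' : HasDerivAt G' G'' (‖x‖ ^ 2))
    (hmin : ∀ᶠ y in 𝓝 x, w x - radialBarrier b F G x ≤ w y - radialBarrier b F G y) :
    4 * ‖x‖ ^ 2 * F'' + 2 * (d + 1) * F' (‖x‖ ^ 2)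
      + x (Fin.last d) * (4 * ‖x‖ ^ 2 * G'' + (2 * (d + 1) + 4) * G' (‖x‖ ^ 2))
      ≤ laplacian (puncturedHalfBall d) w x := by
  have hx0 : 0 < ‖x‖ ^ 2 := by
    have := (halfBall_subset d hx).2
    have : 0 < ‖x‖ := norm_pos_iff.2 this
    positivity
  have key : ∀ i, (F'' * (2 * x i) ^ 2 + 2 * F' (‖x‖ ^ 2))
      + (2 * ((if i = Fin.last d then 1 else 0) * (G' (‖x‖ ^ 2) * (2 * x i)))
      + x (Fin.last d) * (G'' * (2 * x i) ^ 2 + 2 * G' (‖x‖ ^ 2)))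
      ≤ partialDeriv (puncturedHalfBall d) (partialDeriv (puncturedHalfBall d) w i) i x := by
    intro i
    set e : Space d := EuclideanSpace.single i (1 : ℝ) with he
    set δ : ℝ := if i = Fin.last d then 1 else 0 with hδ
    set r : ℝ → ℝ := fun t => ‖x‖ ^ 2 + 2 * t * x i + t ^ 2 with hr
    have hr0 : r 0 = ‖x‖ ^ 2 := by simp [hr]
    have hrd : ∀ t, HasDerivAt r (2 * x i + 2 * t) t := by
      intro t
      have h := ((((hasDerivAt_id t).const_mul 2).mul_const (x i)).const_add (‖x‖ ^ 2)).add
        (hasDerivAt_pow 2 t)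
      refine h.congr_deriv ?_
      simp
    have hrpos : ∀ᶠ t in 𝓝 (0 : ℝ), 0 < r t :=
      (hrd 0).continuousAt.eventually_const_lt (by rw [hr0]; exact hx0)
    have hlin : ∀ t, HasDerivAt (fun t : ℝ => x (Fin.last d) + t * δ) δ t := fun t => by
      simpa using ((hasDerivAt_id t).mul_const δ).const_add (x (Fin.last d))
    have hb : ∀ t, HasDerivAt (fun t : ℝ => ∑ j, b j * x j + t * b i) (b i) t := fun t => by
      simpa using ((hasDerivAt_id t).mul_const (b i)).const_add (∑ j, b j * x j)
    have hd2 : HasDerivAt (fun t : ℝ => 2 * x i + 2 * t) 2 0 := by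
      simpa using ((hasDerivAt_id (0 : ℝ)).const_mul 2).const_add (2 * x i)
    have hq : ∀ᶠ t in 𝓝 (0 : ℝ), HasDerivAt
        (fun t => ∑ j, b j * x j + t * b i + F (r t) + (x (Fin.last d) + t * δ) * G (r t))
        (b i + F' (r t) * (2 * x i + 2 * t) + (δ * G (r t)
          + (x (Fin.last d) + t * δ) * (G' (r t) * (2 * x i + 2 * t)))) t := by
      filter_upwards [hrpos] with t ht
      exact ((hb t).add ((hF _ ht).comp t (hrd t))).add
        ((hlin t).mul ((hG _ ht).comp t (hrd t)))
    have hF0 : HasDerivAt (fun t => F' (r t)) (F'' * (2 * x i + 2 * 0)) 0 :=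
      HasDerivAt.comp (0 : ℝ) (by rw [hr0]; exact hF') (hrd 0)
    have hG0 : HasDerivAt (fun t => G' (r t)) (G'' * (2 * x i + 2 * 0)) 0 :=
      HasDerivAt.comp (0 : ℝ) (by rw [hr0]; exact hG') (hrd 0)
    have hG1 : HasDerivAt (fun t => G (r t)) (G' (r 0) * (2 * x i + 2 * 0)) 0 :=
      HasDerivAt.comp (0 : ℝ) (hG _ (by rw [hr0]; exact hx0)) (hrd 0)
    have hq' := ((hF0.mul hd2).const_add (b i)).add
      ((hG1.const_mul δ).add ((hlin 0).mul (hG0.mul hd2)))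
    have hc : Continuous fun t : ℝ => x + t • e := by fun_prop
    have hm : ∀ᶠ t in 𝓝 (0 : ℝ), w x -
        (∑ j, b j * x j + 0 * b i + F (r 0) + (x (Fin.last d) + 0 * δ) * G (r 0))
        ≤ w (x + t • e) - (∑ j, b j * x j + t * b i + F (r t)
          + (x (Fin.last d) + t * δ) * G (r t)) := by
      have ht0 : Filter.Tendsto (fun t : ℝ => x + t • e) (𝓝 0) (𝓝 x) := by
        simpa using hc.tendsto 0
      filter_upwards [ht0.eventually hmin] with t ht
      rw [radialBarrier_add_smul_single] at ht
      simpa [radialBarrier, r, δ] using ht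
    have h := (line_touch (uniqueDiffOn_puncturedHalfBall d) hw
      ((eventually_line_mem_of_halfBall hx e).mono fun t ht => halfBall_subset d ht) hq hq' hm).2
    have hs : ∀ g : Fin (d + 1) → ℝ, ∑ j, e j * g j = g i := fun g => by
      simp [he]
    rw [hs, hs] at h
    refine le_trans (le_of_eq ?_) h
    simp only [hr0, Pi.mul_apply]
    ring
  have hsum := Finset.sum_le_sum fun i (_ : i ∈ Finset.univ) => key i
  refine le_trans (le_of_eq ?_) hsum
  have e1 : ∑ i, x i ^ 2 = ‖x‖ ^ 2 := (EuclideanSpace.real_norm_sq_eq x).symm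
  have e2 : ∀ a c : ℝ, ∑ i, (a * (2 * x i) ^ 2 + 2 * c) = 4 * ‖x‖ ^ 2 * a + 2 * (d + 1) * c := by
    intro a c
    rw [Finset.sum_add_distrib, ← Finset.mul_sum, ← e1]
    simp only [mul_pow, ← Finset.mul_sum, Finset.sum_const, Finset.card_univ, Fintype.card_fin,
      nsmul_eq_mul]
    push_cast
    ring
  rw [Finset.sum_add_distrib, e2, Finset.sum_add_distrib, ← Finset.mul_sum, ← Finset.mul_sum, e2]
  simp
  ring

end SigmaK

/-! ### From a cone at the origin to a positive gap, for superharmonic functions. -/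

namespace SigmaK

theorem abs_apply_le_norm {d : ℕ} (x : Space d) (i : Fin (d + 1)) : |x i| ≤ ‖x‖ := by
  simpa using PiLp.norm_apply_le x i

theorem continuousOn_radialBarrier {d : ℕ} (b : Fin (d + 1) → ℝ) {F G : ℝ → ℝ}
    (hF : ∀ s, 0 < s → ContinuousAt F s) (hG : ∀ s, 0 < s → ContinuousAt G s) :
    ContinuousOn (radialBarrier b F G) (puncturedHalfBall d) := by
  intro x hx
  have hx0 : 0 < ‖x‖ ^ 2 := by
    have : 0 < ‖x‖ := norm_pos_iff.2 hx.2
    positivity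
  have hn : ContinuousAt (fun y : Space d => ‖y‖ ^ 2) x := by fun_prop
  have h1 : ContinuousAt (fun y : Space d => F (‖y‖ ^ 2)) x := ContinuousAt.comp (f := fun y : Space d => ‖y‖ ^ 2) (hF _ hx0) hn
  have h2 : ContinuousAt (fun y : Space d => G (‖y‖ ^ 2)) x := ContinuousAt.comp (f := fun y : Space d => ‖y‖ ^ 2) (hG _ hx0) hn
  have h3 : ContinuousAt (radialBarrier b F G) x := by
    unfold radialBarrier
    fun_prop
  exact h3.continuousWithinAt

theorem eventually_min_of_mem_halfBall {d : ℕ} {R : ℝ} {f : Space d → ℝ} {x : Space d}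
    (hx : x ∈ halfBall d) (hxR : ‖x‖ < R)
    (hmin : ∀ z ∈ puncturedHalfBall d, ‖z‖ ≤ R → f x ≤ f z) : ∀ᶠ y in 𝓝 x, f x ≤ f y := by
  have h1 : ∀ᶠ y in 𝓝 x, ‖y‖ < R := continuous_norm.continuousAt.eventually_lt_const hxR
  filter_upwards [h1, (isOpen_halfBall d).mem_nhds hx] with y hy1 hy2
  exact hmin y (halfBall_subset d hy2) hy1.le

/-- A superharmonic function with a conical lower bound at the origin grows superlinearly in the
normal direction. -/
theorem log_improvement {d : ℕ} (hd : 1 ≤ d) {w : Space d → ℝ}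
    (hw : ContDiffOn ℝ 2 w (puncturedHalfBall d))
    (hsuper : ∀ x ∈ halfBall d, laplacian (puncturedHalfBall d) w x < 0)
    {R δ c : ℝ} (hR : 0 < R) (hR1 : R < 1) (hδ : 0 < δ) (b : Fin (d + 1) → ℝ)
    (hcone : ∀ x ∈ puncturedHalfBall d, ‖x‖ ≤ R → c + ∑ i, b i * x i + δ * ‖x‖ ≤ w x) :
    ∀ x ∈ puncturedHalfBall d, ‖x‖ ≤ R →
      c + ∑ i, b i * x i + δ * ‖x‖ + x (Fin.last d) * (δ / 2 * (Real.log R - Real.log ‖x‖))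
        ≤ w x := by
  set F : ℝ → ℝ := fun s => c + δ * √s with hF
  -- The added term x_n log(R/|x|) vanishes for x_n = 0 and for |x| = R, so the cone hypothesis
  -- already gives the bound there.
  set G : ℝ → ℝ := fun s => δ / 2 * (Real.log R - 1 / 2 * Real.log s) with hG
  have hB : ∀ x, radialBarrier b F G x = c + ∑ i, b i * x i + δ * ‖x‖
      + x (Fin.last d) * (δ / 2 * (Real.log R - Real.log ‖x‖)) := by
    intro x
    simp only [radialBarrier, hF, hG, Real.sqrt_sq (norm_nonneg x), Real.log_pow]
    push_cast
    ring
  have hFd : ∀ s, 0 < s → HasDerivAt F (δ / 2 * (√s)⁻¹) s := fun s hs => by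
    refine (((Real.hasDerivAt_sqrt hs.ne').const_mul δ).const_add c).congr_deriv ?_
    have := (Real.sqrt_pos.2 hs).ne'
    field_simp
  have hGd : ∀ s, 0 < s → HasDerivAt G (-(δ / 4) * s⁻¹) s := fun s hs => by
    refine ((((Real.hasDerivAt_log hs.ne').const_mul (1 / 2)).const_sub (Real.log R)).const_mul
      (δ / 2)).congr_deriv ?_
    ring
  intro y hy hyR
  rw [← hB]
  by_contra! hlt
  obtain ⟨x, hx, hxR, hxy, hmin⟩ := exists_min_of_lt_near_zero (R := R)
    (f := fun x => w x - radialBarrier b F G x)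
    (hw.continuousOn.sub (continuousOn_radialBarrier b (fun s hs => (hFd s hs).continuousAt)
      fun s hs => (hGd s hs).continuousAt)) hy hyR (by
    -- Near the origin the added term is at most δ/2 · |x| log(R/|x|), which tends to 0.
    set g : ℝ → ℝ := fun s => δ / 2 * (s * Real.log R - s * Real.log s) with hg
    have hgc : Continuous g := by
      have := Real.continuous_mul_log
      fun_prop
    have hg0 : g 0 = 0 := by simp [hg]
    have hev : ∀ᶠ s in 𝓝 (0 : ℝ), g s < -(w y - radialBarrier b F G y) :=
      hgc.continuousAt.eventually_lt_const (by rw [hg0]; linarith)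
    obtain ⟨ρ, hρ, hball⟩ := Metric.eventually_nhds_iff.1 hev
    refine ⟨min ρ R, lt_min hρ hR, fun x hx hxρ => ?_⟩
    have h1 := hball (y := ‖x‖) (by
      rw [Real.dist_0_eq_abs, abs_of_nonneg (norm_nonneg x)]; exact hxρ.trans_le (min_le_left _ _))
    have hxR : ‖x‖ ≤ R := (hxρ.trans_le (min_le_right _ _)).le
    have h2 := hcone x hx hxR
    have h3 : x (Fin.last d) ≤ ‖x‖ := (le_abs_self _).trans (abs_apply_le_norm x _)
    have h4 : 0 ≤ δ / 2 * (Real.log R - Real.log ‖x‖) := by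
      have := Real.log_le_log (norm_pos_iff.2 hx.2) hxR
      have : 0 ≤ Real.log R - Real.log ‖x‖ := by linarith
      positivity
    have h5 := mul_le_mul_of_nonneg_right h3 h4
    rw [hB x]
    simp only [hg] at h1
    nlinarith)
  have hfx : w x - radialBarrier b F G x < 0 := hxy.trans_lt (by linarith)
  have hxc := hcone x hx hxR
  rw [hB] at hfx
  rcases hxR.lt_or_eq with hxR | hxR
  swap
  · rw [hxR, sub_self] at hfx
    rw [hxR] at hxc
    linarith
  rcases hx.1.2.lt_or_eq with hn | hn
  swap
  · rw [← hn, zero_mul] at hfx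
    linarith
  have hxB : x ∈ halfBall d := ⟨by linarith, hn⟩
  have hpos : 0 < ‖x‖ := norm_pos_iff.2 hx.2
  have hs0 : 0 < ‖x‖ ^ 2 := by positivity
  have hF2 : HasDerivAt (fun s : ℝ => δ / 2 * (√s)⁻¹) (-(δ / 4) / ‖x‖ ^ 3) (‖x‖ ^ 2) := by
    have h := ((Real.hasDerivAt_sqrt hs0.ne').fun_inv (Real.sqrt_pos.2 hs0).ne').const_mul (δ / 2)
    rw [Real.sqrt_sq hpos.le] at h
    refine h.congr_deriv ?_
    field_simp
    ring
  have hG2 : HasDerivAt (fun s : ℝ => -(δ / 4) * s⁻¹) (δ / 4 / ‖x‖ ^ 4) (‖x‖ ^ 2) := by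
    refine ((hasDerivAt_inv hs0.ne').const_mul (-(δ / 4))).congr_deriv ?_
    field_simp
  have hL := laplacian_ge_of_touch hw hxB hFd hGd hF2 hG2
    (eventually_min_of_mem_halfBall (f := fun x => w x - radialBarrier b F G x) hxB hxR hmin)
  have hlt := hsuper x hxB
  rw [Real.sqrt_sq hpos.le] at hL
  have hxn : x (Fin.last d) ≤ ‖x‖ := (le_abs_self _).trans (abs_apply_le_norm x _)
  have e : 4 * ‖x‖ ^ 2 * (-(δ / 4) / ‖x‖ ^ 3) + 2 * (d + 1) * (δ / 2 * ‖x‖⁻¹)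
      + x (Fin.last d) * (4 * ‖x‖ ^ 2 * (δ / 4 / ‖x‖ ^ 4)
        + (2 * (d + 1) + 4) * (-(δ / 4) * (‖x‖ ^ 2)⁻¹))
      = δ / (2 * ‖x‖ ^ 2) * (2 * d * ‖x‖ - (d + 1) * x (Fin.last d)) := by
    field_simp
    ring
  rw [e] at hL
  have hd' : (1 : ℝ) ≤ d := by exact_mod_cast hd
  -- The barrier is subharmonic: the cone's Laplacian dominates that of the logarithmic term, since
  -- x_n ≤ |x| and d + 1 ≤ 2d.
  have : 0 ≤ δ / (2 * ‖x‖ ^ 2) * (2 * d * ‖x‖ - (d + 1) * x (Fin.last d)) := by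
    apply mul_nonneg (by positivity)
    nlinarith
  linarith

/-- A superharmonic function with the right sign of the normal derivative and a conical lower
bound relative to a tangential affine function lies strictly above that function. -/
theorem gap_of_tangential_cone {d : ℕ} (hd : 1 ≤ d) {w : Space d → ℝ}
    (hw : ContDiffOn ℝ 2 w (puncturedHalfBall d))
    (hsuper : ∀ x ∈ halfBall d, laplacian (puncturedHalfBall d) w x < 0)
    (hnormal : ∀ x ∈ flatBoundary d \ {0},
      partialDeriv (puncturedHalfBall d) w (Fin.last d) x ≤ 0)
    {R δ c : ℝ} (hR : 0 < R) (hR1 : R < 1) (hδ : 0 < δ) {b : Fin (d + 1) → ℝ}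
    (hb : b (Fin.last d) = 0)
    (hcone : ∀ x ∈ puncturedHalfBall d, ‖x‖ ≤ R → c + ∑ i, b i * x i + δ * ‖x‖ ≤ w x) :
    ∀ x ∈ puncturedHalfBall d, ‖x‖ ≤ R → c + δ * R / 2 + ∑ i, b i * x i ≤ w x := by
  have main : ∀ ε > 0, ∀ x ∈ puncturedHalfBall d, ‖x‖ ≤ R →
      c + δ * R / 2 + ∑ i, b i * x i + ε * (Real.log ‖x‖ - Real.log R)
        + x (Fin.last d) * (δ / 2) ≤ w x := by
    intro ε hε
    -- The term ε log |x| removes the puncture and is subharmonic as n ≥ 2. The extra δ/2 · x_n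
    -- gives normal derivative δ/2 > 0 on the flat part; with the constant δR/2 it still fits under
    -- the cone height δR on |x| = R.
    set F : ℝ → ℝ := fun s => c + δ * R / 2 + ε * (1 / 2 * Real.log s - Real.log R) with hF
    set G : ℝ → ℝ := fun _ => δ / 2 with hG
    have hB : ∀ x, radialBarrier b F G x = c + δ * R / 2 + ∑ i, b i * x i
        + ε * (Real.log ‖x‖ - Real.log R) + x (Fin.last d) * (δ / 2) := by
      intro x
      simp only [radialBarrier, hF, hG, Real.log_pow]
      push_cast
      ring
    have hFd : ∀ s, 0 < s → HasDerivAt F (ε / 2 * s⁻¹) s := fun s hs => by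
      refine (((((Real.hasDerivAt_log hs.ne').const_mul (1 / 2)).sub_const (Real.log R)).const_mul
        ε).const_add (c + δ * R / 2)).congr_deriv ?_
      ring
    have hGd : ∀ s, 0 < s → HasDerivAt G 0 s := fun s _ => hasDerivAt_const _ _
    intro y hy hyR
    rw [← hB]
    by_contra! hlt
    obtain ⟨x, hx, hxR, hxy, hmin⟩ := exists_min_of_lt_near_zero (R := R)
      (f := fun x => w x - radialBarrier b F G x)
      (hw.continuousOn.sub (continuousOn_radialBarrier b (fun s hs => (hFd s hs).continuousAt)
        fun s hs => (hGd s hs).continuousAt)) hy hyR (by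
      -- Below this radius ε log(|x|/R) ≤ -δR, which outweighs δR/2 and δ/2 · x_n ≤ δR/2.
      refine ⟨min R (Real.exp (Real.log R - δ * R / ε)), lt_min hR (Real.exp_pos _),
        fun x hx hxρ => ?_⟩
      have hpos := norm_pos_iff.2 hx.2
      have hxR : ‖x‖ ≤ R := (hxρ.trans_le (min_le_left _ _)).le
      have h2 := hcone x hx hxR
      have h3 : x (Fin.last d) ≤ ‖x‖ := (le_abs_self _).trans (abs_apply_le_norm x _)
      have h4 : Real.log ‖x‖ ≤ Real.log R - δ * R / ε :=
        ((Real.log_lt_iff_lt_exp hpos).2 (hxρ.trans_le (min_le_right _ _))).le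
      have h5 : ε * (Real.log ‖x‖ - Real.log R) ≤ -(δ * R) := by
        have := mul_le_mul_of_nonneg_left h4 hε.le
        have e : ε * (Real.log R - δ * R / ε) = ε * Real.log R - δ * R := by
          field_simp
        linarith
      have h6 : x (Fin.last d) * (δ / 2) ≤ R * (δ / 2) :=
        mul_le_mul_of_nonneg_right (h3.trans hxR) (by linarith)
      have h7 : 0 ≤ δ * ‖x‖ := by positivity
      rw [hB x]
      linarith)
    have hfx : w x - radialBarrier b F G x < 0 := hxy.trans_lt (by linarith)
    have hpos : 0 < ‖x‖ := norm_pos_iff.2 hx.2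
    have hs0 : 0 < ‖x‖ ^ 2 := by positivity
    rcases hxR.lt_or_eq with hxR | hxR
    swap
    · have hxc := hcone x hx hxR.le
      have h3 : x (Fin.last d) ≤ ‖x‖ := (le_abs_self _).trans (abs_apply_le_norm x _)
      have h6 : x (Fin.last d) * (δ / 2) ≤ R * (δ / 2) :=
        mul_le_mul_of_nonneg_right (h3.trans hxR.le) (by linarith)
      rw [hB, hxR, sub_self] at hfx
      rw [hxR] at hxc
      linarith
    rcases hx.1.2.lt_or_eq with hn | hn
    · have hxB : x ∈ halfBall d := ⟨by linarith, hn⟩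
      have hF2 : HasDerivAt (fun s : ℝ => ε / 2 * s⁻¹) (-(ε / 2) / ‖x‖ ^ 4) (‖x‖ ^ 2) := by
        refine ((hasDerivAt_inv hs0.ne').const_mul (ε / 2)).congr_deriv ?_
        field_simp
      have hL := laplacian_ge_of_touch hw hxB hFd hGd hF2 (hasDerivAt_const _ (0 : ℝ))
        (eventually_min_of_mem_halfBall (f := fun x => w x - radialBarrier b F G x) hxB hxR hmin)
      have hlt := hsuper x hxB
      have e : 4 * ‖x‖ ^ 2 * (-(ε / 2) / ‖x‖ ^ 4) + 2 * (d + 1) * (ε / 2 * (‖x‖ ^ 2)⁻¹)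
          + x (Fin.last d) * (4 * ‖x‖ ^ 2 * 0 + (2 * (d + 1) + 4) * 0)
          = ε / ‖x‖ ^ 2 * (d - 1) := by
        field_simp
        ring
      rw [e] at hL
      have hd' : (1 : ℝ) ≤ d := by exact_mod_cast hd
      have : 0 ≤ ε / ‖x‖ ^ 2 * (d - 1) := mul_nonneg (by positivity) (by linarith)
      linarith
    · have hxF : x ∈ flatBoundary d \ {0} := ⟨⟨by linarith, hn.symm⟩, hx.2⟩
      set e : Space d := EuclideanSpace.single (Fin.last d) (1 : ℝ) with he
      have hr : HasDerivAt (fun t : ℝ => ‖x‖ ^ 2 + 2 * t * x (Fin.last d) + t ^ 2) 0 0 := by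
        simp only [← hn, mul_zero, add_zero]
        simpa using (hasDerivAt_pow 2 (0 : ℝ)).const_add (‖x‖ ^ 2)
      have hF0 : HasDerivAt
          (fun t : ℝ => F (‖x‖ ^ 2 + 2 * t * x (Fin.last d) + t ^ 2)) 0 0 := by
        have := HasDerivAt.comp (0 : ℝ) (h₂ := F) (by simpa using hFd _ hs0) hr
        exact this.congr_deriv (mul_zero _)
      have hq : HasDerivAt (fun t : ℝ => radialBarrier b F G (x + t • e)) (δ / 2) 0 := by
        simp only [he, radialBarrier_add_smul_single, hb, mul_zero, add_zero, if_true, mul_one, ← hn,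
          zero_add, hG]
        simp only [← hn] at hF0
        simp only [mul_zero, add_zero] at hF0
        have := (hF0.const_add (∑ j, b j * x j)).add ((hasDerivAt_id (0 : ℝ)).mul_const (δ / 2))
        exact this.congr_deriv (by ring)
      have ht := normal_touch (hw.differentiableOn two_ne_zero) hxF hq.hasDerivWithinAt (by
        have hc : Continuous fun t : ℝ => x + t • e := by fun_prop
        have h1 : ∀ᶠ t in 𝓝 (0 : ℝ), ‖x + t • e‖ < R :=
          hc.norm.continuousAt.eventually_lt_const (by simpa using hxR)
        filter_upwards [nhdsWithin_le_nhds h1, eventually_line_mem_normal hxF] with t ht1 ht2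
        simpa using hmin _ ht2 ht1.le)
      have := hnormal x hxF
      linarith
  intro x hx hxR
  have hxn : 0 ≤ x (Fin.last d) * (δ / 2) := mul_nonneg hx.1.2 (by linarith)
  -- Let ε → 0 at the fixed point x.
  refine le_of_forall_pos_le_add fun η hη => ?_
  set L := Real.log R - Real.log ‖x‖ with hL
  have hL0 : 0 ≤ L := by
    have := Real.log_le_log (norm_pos_iff.2 hx.2) hxR
    linarith
  have h := main (η / (L + 1)) (by positivity) x hx hxR
  have h2 : η / (L + 1) * L ≤ η := by
    rw [div_mul_eq_mul_div, div_le_iff₀ (by linarith)]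
    nlinarith
  have e : η / (L + 1) * (Real.log ‖x‖ - Real.log R) = -(η / (L + 1) * L) := by
    rw [hL]; ring
  rw [e] at h
  linarith

theorem gap_of_cone {d : ℕ} (hd : 1 ≤ d) {w : Space d → ℝ}
    (hw : ContDiffOn ℝ 2 w (puncturedHalfBall d))
    (hsuper : ∀ x ∈ halfBall d, laplacian (puncturedHalfBall d) w x < 0)
    (hnormal : ∀ x ∈ flatBoundary d \ {0},
      partialDeriv (puncturedHalfBall d) w (Fin.last d) x ≤ 0)
    {R δ c : ℝ} (hR : 0 < R) (hR1 : R < 1) (hδ : 0 < δ) (b : Fin (d + 1) → ℝ)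
    (hcone : ∀ x ∈ puncturedHalfBall d, ‖x‖ ≤ R → c + ∑ i, b i * x i + δ * ‖x‖ ≤ w x) :
    ∃ ρ > 0, ∃ κ > 0, ∀ x ∈ puncturedHalfBall d, ‖x‖ ≤ ρ →
      c + κ + ∑ i, (if i = Fin.last d then 0 else b i) * x i ≤ w x := by
  have h1 := log_improvement hd hw hsuper hR hR1 hδ b hcone
  -- For |x| at most R exp(-2|b_n|/δ) the logarithmic gain is at least |b_n| x_n and swallows the
  -- normal slope.
  set ρ := min R (Real.exp (Real.log R - 2 * |b (Fin.last d)| / δ)) with hρ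
  have hρ0 : 0 < ρ := lt_min hR (Real.exp_pos _)
  refine ⟨ρ, hρ0, δ * ρ / 2, by positivity, fun x hx hxρ => ?_⟩
  have := gap_of_tangential_cone hd hw hsuper hnormal hρ0 ((min_le_left _ _).trans_lt hR1) hδ
    (c := c) (b := fun i => if i = Fin.last d then 0 else b i) (by simp) (fun z hz hzρ => by
      have hzR := hzρ.trans (min_le_left _ _)
      have h2 := h1 z hz hzR
      have h4 : Real.log ‖z‖ ≤ Real.log R - 2 * |b (Fin.last d)| / δ :=
        (Real.log_le_iff_le_exp (norm_pos_iff.2 hz.2)).2 (hzρ.trans (min_le_right _ _))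
      have h5 : |b (Fin.last d)| ≤ δ / 2 * (Real.log R - Real.log ‖z‖) := by
        have h6 : 2 * |b (Fin.last d)| / δ ≤ Real.log R - Real.log ‖z‖ := by linarith
        rw [div_le_iff₀ hδ] at h6
        linarith
      have h6 := mul_le_mul_of_nonneg_left ((neg_le_abs (b (Fin.last d))).trans h5) hz.1.2
      simp only [Fin.sum_univ_castSucc, Fin.castSucc_ne_last, if_false, if_true, zero_mul,
        add_zero] at h2 ⊢
      linarith) x hx hxρ
  exact this

end SigmaK

/-! ### Comparison of the operators at a contact point. -/

namespace SigmaK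

open Matrix

/-- Away from the origin the two sets coincide locally, so the derivatives within them agree. -/
theorem jetOf_punctured {d : ℕ} {v : Space d → ℝ} {x : Space d} (hx : x ∈ puncturedHalfBall d) :
    jetOf (puncturedHalfBall d) v x = jetOf (closedHalfBall d) v x := by
  have key : ∀ (f : Space d → ℝ), ∀ y ∈ puncturedHalfBall d, ∀ i,
      partialDeriv (puncturedHalfBall d) f i y = partialDeriv (closedHalfBall d) f i y := by
    intro f y hy i
    have : fderivWithin ℝ f (closedHalfBall d ∩ {0}ᶜ) y = fderivWithin ℝ f (closedHalfBall d) y :=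
      fderivWithin_inter (isOpen_compl_singleton.mem_nhds hy.2)
    rw [partialDeriv, partialDeriv, ← this]
    rfl
  have key2 : ∀ i j, partialDeriv (puncturedHalfBall d) (partialDeriv (puncturedHalfBall d) v j) i x
      = partialDeriv (closedHalfBall d) (partialDeriv (closedHalfBall d) v j) i x := by
    intro i j
    rw [← key _ x hx]
    simp only [partialDeriv]
    have h := fderivWithin_congr (𝕜 := ℝ) (fun y hy => key v y hy j) (key v x hx j)
    exact congrArg (fun L => L (EuclideanSpace.single i 1)) h
  simp only [jetOf, key2, key v x hx]

theorem esig_one {ι : Type*} [Fintype ι] [DecidableEq ι] [Nonempty ι] (M : Matrix ι ι ℝ) :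
    esig 1 M = M.trace := by
  have := Matrix.trace_eq_neg_charpoly_coeff (-M)
  rw [trace_neg, neg_inj] at this
  exact this.symm

/-- The trace of the matrix is -Δw - (n-2)/2 |∇w|². -/
theorem laplacian_neg {d : ℕ} (hd : 1 ≤ d) {S : Set (Space d)} {w : Space d → ℝ} {x : Space d}
    (h : PosCone 1 (schout (jetOf S w x).2.1 (jetOf S w x).2.2)) : laplacian S w x < 0 := by
  have h1 := h.2 1 le_rfl
  rw [esig_one] at h1
  have e : (schout (jetOf S w x).2.1 (jetOf S w x).2.2).trace
      = -laplacian S w x - (d - 1) / 2 * ∑ m, (jetOf S w x).2.2 m ^ 2 := by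
    simp only [trace, diag_apply, schout, of_apply, if_true, mul_one, Finset.sum_sub_distrib,
      Finset.sum_add_distrib, Finset.sum_neg_distrib, laplacian, Finset.sum_const, Finset.card_univ,
      Fintype.card_fin, nsmul_eq_mul, ← sq]
    simp only [jetOf]
    push_cast
    ring
  have hd' : (1 : ℝ) ≤ d := by exact_mod_cast hd
  have : 0 ≤ ((d : ℝ) - 1) / 2 * ∑ m, (jetOf S w x).2.2 m ^ 2 :=
    mul_nonneg (by linarith) (Finset.sum_nonneg fun _ _ => sq_nonneg _)
  linarith

theorem PosCone.schoutTang {d l : ℕ} (hl1 : 1 ≤ l) (hl : l ≤ d + 1) {j : Jet d}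
    (h : PosCone l (schout j.2.1 j.2.2)) :
    PosCone (l - 1) (schoutTang j.2.1 j.2.2 + (-(j.2.2 (Fin.last d) ^ 2 / 2)) • 1) := by
  rw [← tangential_schout]
  obtain ⟨m, rfl⟩ : ∃ m, l = m + 1 := ⟨l - 1, by omega⟩
  exact h.tangential (by omega)

/-- With a positive normal derivative every summand of the boundary operator would be negative. -/
theorem normal_nonpos_of_boundaryOp_nonneg {d l : ℕ} (hl1 : 1 ≤ l) (hl : l ≤ d + 1) {j : Jet d}
    (h : PosCone l (schout j.2.1 j.2.2)) (hB : 0 ≤ boundaryOp l j) : j.2.2 (Fin.last d) ≤ 0 := by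
  by_contra! hy
  have h1 := bdryFun_neg hl1 hy (h.schoutTang hl1 hl)
  have : boundaryOp l j < 0 := mul_neg_of_pos_of_neg (Real.exp_pos _) h1
  linarith

theorem symm_of_schout_isHermitian {d : ℕ} {H : Fin (d + 1) → Fin (d + 1) → ℝ}
    {g : Fin (d + 1) → ℝ} (h : (schout H g).IsHermitian) (i j : Fin (d + 1)) : H i j = H j i := by
  have := h.apply i j
  simp only [schout, of_apply, star_trivial] at this
  have e : (if j = i then (1 : ℝ) else 0) = if i = j then 1 else 0 := by simp [eq_comm]
  rw [e] at this
  linarith [mul_comm (g i) (g j)]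

theorem posSemidef_of_symm {ι : Type*} [Fintype ι] {D : ι → ι → ℝ} (hs : ∀ i j, D i j = D j i)
    (h : ∀ ξ : ι → ℝ, 0 ≤ ∑ i, ξ i * ∑ j, ξ j * D j i) : (Matrix.of D).PosSemidef := by
  refine PosSemidef.of_dotProduct_mulVec_nonneg ?_ fun ξ => ?_
  · ext i j
    exact hs j i
  · refine (h ξ).trans (le_of_eq ?_)
    simp only [dotProduct, mulVec, star_trivial, of_apply]
    refine Finset.sum_congr rfl fun i _ => ?_
    congr 1
    refine Finset.sum_congr rfl fun j _ => ?_
    rw [hs i j, mul_comm]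

/-- Comparison of the interior operator at a point where the second jet lies above first. -/
theorem interiorOp_le_of_touch {d k : ℕ} (hk : k ≤ d + 1) (p : ℝ) {j₁ j₂ : Jet d}
    (h1 : PosCone k (schout j₁.2.1 j₁.2.2)) (hs : ∀ i i', j₂.2.1 i i' = j₂.2.1 i' i)
    (hval : j₁.1 = j₂.1) (hgrad : j₁.2.2 = j₂.2.2)
    (hhess : ∀ ξ : Fin (d + 1) → ℝ, ∑ i, ξ i * ∑ i', ξ i' * j₂.2.1 i' i
      ≤ ∑ i, ξ i * ∑ i', ξ i' * j₁.2.1 i' i) :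
    interiorOp p k j₁ ≤ interiorOp p k j₂ := by
  have hD : (Matrix.of fun i i' => j₁.2.1 i i' - j₂.2.1 i i').PosSemidef := by
    refine posSemidef_of_symm (fun i i' => ?_) fun ξ => ?_
    · rw [hs, symm_of_schout_isHermitian h1.1 i i']
    · have := hhess ξ
      simp only [mul_sub, Finset.sum_sub_distrib] at this ⊢
      linarith
  have e : schout j₂.2.1 j₂.2.2
      = schout j₁.2.1 j₁.2.2 + Matrix.of fun i i' => j₁.2.1 i i' - j₂.2.1 i i' := by
    ext i i'
    simp only [schout, of_apply, Matrix.add_apply, hgrad]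
    ring
  rw [interiorOp, interiorOp, e, hval]
  exact mul_le_mul_of_nonneg_left ((h1.add_posSemidef (by simpa using hk) hD).2 k le_rfl)
    (Real.exp_pos _).le

/-- Comparison of the boundary operator at a flat boundary point where a function is touched from
below. -/
theorem boundaryOp_le_of_touch {d l : ℕ} (hl1 : 1 ≤ l) (hl : l ≤ d + 1) {j₁ j₂ : Jet d}
    (h1 : PosCone l (schout j₁.2.1 j₁.2.2)) (hB : 0 ≤ boundaryOp l j₁)
    (hs : ∀ i i', j₂.2.1 i i' = j₂.2.1 i' i)
    (h2 : ∀ i ≤ l - 1,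
      0 < esig i (schoutTang j₂.2.1 j₂.2.2 + (-(j₂.2.2 (Fin.last d) ^ 2 / 2)) • 1))
    (hval : j₁.1 = j₂.1) (hgrad : ∀ i : Fin d, j₁.2.2 i.castSucc = j₂.2.2 i.castSucc)
    (hnormal : j₂.2.2 (Fin.last d) ≤ j₁.2.2 (Fin.last d))
    (hhess : ∀ ξ : Fin (d + 1) → ℝ, ξ (Fin.last d) = 0 → ∑ i, ξ i * ∑ i', ξ i' * j₂.2.1 i' i
      ≤ ∑ i, ξ i * ∑ i', ξ i' * j₁.2.1 i' i) :
    boundaryOp l j₁ ≤ boundaryOp l j₂ := by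
  have hy := normal_nonpos_of_boundaryOp_nonneg hl1 hl h1 hB
  set D : Fin d → Fin d → ℝ :=
    fun i i' => j₁.2.1 i.castSucc i'.castSucc - j₂.2.1 i.castSucc i'.castSucc with hDdef
  have hD : (Matrix.of D).PosSemidef := by
    refine posSemidef_of_symm (fun i i' => ?_) fun ξ => ?_
    · simp only [hDdef]
      rw [hs, symm_of_schout_isHermitian h1.1 i.castSucc i'.castSucc]
    · have := hhess (Fin.snoc (α := fun _ => ℝ) ξ 0) (by simp)
      simp only [Fin.sum_univ_castSucc, Fin.snoc_castSucc, Fin.snoc_last, zero_mul, add_zero]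
        at this
      simp only [hDdef, mul_sub, Finset.sum_sub_distrib]
      linarith
  have e : schoutTang j₂.2.1 j₂.2.2 = schoutTang j₁.2.1 j₁.2.2 + Matrix.of D := by
    ext i i'
    simp only [schoutTang, of_apply, Matrix.add_apply, hgrad, hDdef]
    ring
  have hherm : (schoutTang j₂.2.1 j₂.2.2 + (-(j₂.2.2 (Fin.last d) ^ 2 / 2)) • 1).IsHermitian := by
    ext i i'
    simp only [schoutTang, conjTranspose_apply, Matrix.add_apply, of_apply, Matrix.smul_apply,
      one_apply, star_trivial, smul_eq_mul, hs i.castSucc, eq_comm (a := i')]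
    ring
  rw [boundaryOp, boundaryOp, hval]
  refine mul_le_mul_of_nonneg_left ?_ (Real.exp_pos _).le
  -- Two moves: raise the tangential matrix at the normal derivative of j₁, then lower the normal
  -- derivative to that of j₂. The second needs the cone condition only at the j₂ end.
  refine (bdryFun_le_add hl hy (h1.schoutTang hl1 hl) hD).trans ?_
  rw [← e]
  exact bdryFun_antitone hl1 hl hnormal hy ⟨hherm, h2⟩

end SigmaK

/-! ### The quadratic perturbation and its contact relations. -/

namespace SigmaK

open Matrix

/-- The quadratic function `-|x|² + μ x_n + M x_n² + ⟨a, x⟩ + m`. -/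
noncomputable def bump {d : ℕ} (μ M : ℝ) (a : Fin (d + 1) → ℝ) (m : ℝ) (x : Space d) : ℝ :=
  -‖x‖ ^ 2 + μ * x (Fin.last d) + M * x (Fin.last d) ^ 2 + ∑ i, a i * x i + m

/-- The gradient of `bump`. -/
noncomputable def bumpGrad {d : ℕ} (μ M : ℝ) (a : Fin (d + 1) → ℝ) (x : Space d) :
    Fin (d + 1) → ℝ :=
  fun i => -2 * x i + (μ + 2 * M * x (Fin.last d)) * (if i = Fin.last d then 1 else 0) + a i

/-- The jet of `bump`. -/
noncomputable def bumpJet {d : ℕ} (μ M : ℝ) (a : Fin (d + 1) → ℝ) (m : ℝ) (x : Space d) : Jet d :=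
  (bump μ M a m x, barrierHess d M, bumpGrad μ M a x)

theorem barrierHess_symm {d : ℕ} (M : ℝ) (i j : Fin (d + 1)) :
    barrierHess d M i j = barrierHess d M j i := by
  simp only [barrierHess, lastEntry, eq_comm (a := i) (b := j), and_comm]

theorem continuous_bumpJet {d : ℕ} (μ M : ℝ) :
    Continuous fun q : Space d × (Fin (d + 1) → ℝ) × ℝ => bumpJet μ M q.2.1 q.2.2 q.1 := by
  unfold bumpJet bump bumpGrad
  fun_prop

/-- An exact second-order expansion, which identifies `bumpGrad` and `barrierHess` as the gradient
and Hessian. -/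
theorem bump_line {d : ℕ} (μ M : ℝ) (a : Fin (d + 1) → ℝ) (m : ℝ) (x ξ : Space d) (t : ℝ) :
    bump μ M a m (x + t • ξ) = bump μ M a m x + t * ∑ i, ξ i * bumpGrad μ M a x i
      + t ^ 2 / 2 * ∑ i, ξ i * ∑ j, ξ j * barrierHess d M j i := by
  have e1 : ∑ i, ξ i * bumpGrad μ M a x i
      = -2 * ∑ i, x i * ξ i + (μ + 2 * M * x (Fin.last d)) * ξ (Fin.last d) + ∑ i, a i * ξ i := by
    simp only [bumpGrad, mul_add, Finset.sum_add_distrib]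
    congr 1
    · congr 1
      · rw [Finset.mul_sum]
        exact Finset.sum_congr rfl fun i _ => by ring
      · simp
        ring
    · exact Finset.sum_congr rfl fun i _ => by ring
  have e2 : ∑ i, ξ i * ∑ j, ξ j * barrierHess d M j i
      = -2 * ∑ i, ξ i ^ 2 + 2 * M * ξ (Fin.last d) ^ 2 := by
    have : ∀ i, ξ i * ∑ j, ξ j * barrierHess d M j i
        = -2 * ξ i ^ 2 + (if i = Fin.last d then 2 * M * ξ (Fin.last d) ^ 2 else 0) := by
      intro i
      simp only [barrierHess, lastEntry, mul_add, Finset.sum_add_distrib]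
      by_cases hi : i = Fin.last d
      · subst hi
        simp
        ring
      · simp [hi]
        ring
    simp only [this, Finset.sum_add_distrib, ← Finset.mul_sum]
    simp
  have e3 : ∀ y : Space d, ‖y‖ ^ 2 = ∑ i, y i ^ 2 := EuclideanSpace.real_norm_sq_eq
  rw [e1, e2, bump, bump, e3, e3]
  simp only [PiLp.add_apply, PiLp.smul_apply, smul_eq_mul, add_sq, mul_add, mul_pow,
    Finset.sum_add_distrib]
  have e4 : ∑ i, 2 * x i * (t * ξ i) = 2 * t * ∑ i, x i * ξ i := by
    rw [Finset.mul_sum]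
    exact Finset.sum_congr rfl fun i _ => by ring
  have e5 : ∑ i, a i * (t * ξ i) = t * ∑ i, a i * ξ i := by
    rw [Finset.mul_sum]
    exact Finset.sum_congr rfl fun i _ => by ring
  rw [e4, e5, ← Finset.mul_sum]
  ring

theorem abs_bump_le {d : ℕ} (μ M : ℝ) (a : Fin (d + 1) → ℝ) (x : Space d) (ha : ‖a‖ ≤ 1)
    (hx : ‖x‖ ≤ 1) : |bump μ M a 0 x| ≤ (2 + |μ| + |M| + d) * ‖x‖ := by
  have h0 := norm_nonneg x
  have h1 := abs_apply_le_norm x (Fin.last d)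
  have h2 : |∑ i, a i * x i| ≤ (d + 1) * ‖x‖ := by
    refine (Finset.abs_sum_le_sum_abs _ _).trans ?_
    have : ∀ i ∈ (Finset.univ : Finset (Fin (d + 1))), |a i * x i| ≤ ‖x‖ := fun i _ => by
      rw [abs_mul]
      have h3 : |a i| ≤ 1 := (norm_le_pi_norm a i).trans ha
      nlinarith [abs_apply_le_norm x i, abs_nonneg (x i)]
    refine (Finset.sum_le_sum this).trans (le_of_eq ?_)
    simp
  have h3 : |μ * x (Fin.last d)| ≤ |μ| * ‖x‖ := by
    rw [abs_mul]; exact mul_le_mul_of_nonneg_left h1 (abs_nonneg _)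
  have h4 : |M * x (Fin.last d) ^ 2| ≤ |M| * ‖x‖ := by
    rw [abs_mul, abs_pow]
    refine mul_le_mul_of_nonneg_left ?_ (abs_nonneg _)
    nlinarith [abs_nonneg (x (Fin.last d))]
  have h5 : |-‖x‖ ^ 2| ≤ ‖x‖ := by
    rw [abs_neg, abs_pow, abs_norm]; nlinarith
  rw [bump, add_zero]
  refine (abs_add_le _ _).trans ?_
  have h6 := abs_add_le (-‖x‖ ^ 2 + μ * x (Fin.last d)) (M * x (Fin.last d) ^ 2)
  have h7 := abs_add_le (-‖x‖ ^ 2) (μ * x (Fin.last d))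
  linarith

/-- The jet relations at a point where `u - v - ε bump` has a minimum along a line. -/
theorem jet_touch_line {d : ℕ} {S : Set (Space d)} (hS : UniqueDiffOn ℝ S) {u v : Space d → ℝ}
    (hu : ContDiffOn ℝ 2 u S) (hv : ContDiffOn ℝ 2 v S) {x ξ : Space d}
    (hT : ∀ᶠ s in 𝓝 (0 : ℝ), x + s • ξ ∈ S) {μ M ε m : ℝ} {a : Fin (d + 1) → ℝ}
    (hmin : ∀ᶠ t in 𝓝 (0 : ℝ), u x - (v x + ε * bump μ M a m x)
      ≤ u (x + t • ξ) - (v (x + t • ξ) + ε * bump μ M a m (x + t • ξ))) :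
    ∑ i, ξ i * (jetOf S u x).2.2 i = ∑ i, ξ i * (jetOf S v x + ε • bumpJet μ M a m x).2.2 i ∧
      ∑ i, ξ i * ∑ j, ξ j * (jetOf S v x + ε • bumpJet μ M a m x).2.1 j i
        ≤ ∑ i, ξ i * ∑ j, ξ j * (jetOf S u x).2.1 j i := by
  set B := ∑ i, ξ i * bumpGrad μ M a x i with hB
  set C := ∑ i, ξ i * ∑ j, ξ j * barrierHess d M j i with hC
  have hbump : ∀ t : ℝ, HasDerivAt (fun t : ℝ => bump μ M a m x + t * B + t ^ 2 / 2 * C)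
      (B + t * C) t := fun t => by
    refine ((((hasDerivAt_id t).mul_const B).const_add _).add
      (((hasDerivAt_pow 2 t).div_const 2).mul_const C)).congr_deriv ?_
    simp
  have hq : ∀ᶠ t in 𝓝 (0 : ℝ), HasDerivAt (fun t => v (x + t • ξ) + ε * bump μ M a m (x + t • ξ))
      (∑ i, ξ i * partialDeriv S v i (x + t • ξ) + ε * (B + t * C)) t := by
    filter_upwards [hT.eventually_nhds] with t ht
    simp only [bump_line]
    exact (hasDerivAt_line_of_eventually (hv.differentiableOn two_ne_zero) ht).add
      ((hbump t).const_mul ε)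
  have hq' := (hasDerivAt_line_deriv hS hv hT).add
    ((((hasDerivAt_id (0 : ℝ)).mul_const C).const_add B).const_mul ε)
  obtain ⟨h1, h2⟩ := line_touch hS hu hT hq hq' (by simpa using hmin)
  constructor
  · have e : ∑ i, ξ i * (jetOf S v x + ε • bumpJet μ M a m x).2.2 i
        = ∑ i, ξ i * partialDeriv S v i x + ε * B := by
      simp only [jetOf, bumpJet, Prod.snd_add, Prod.smul_snd, Pi.add_apply, Pi.smul_apply,
        smul_eq_mul, mul_add, Finset.sum_add_distrib, hB, Finset.mul_sum]
      congr 1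
      exact Finset.sum_congr rfl fun i _ => by ring
    rw [e]
    simp only [zero_smul, add_zero, zero_mul] at h1
    simpa [jetOf] using h1
  · have e : ∑ i, ξ i * ∑ j, ξ j * (jetOf S v x + ε • bumpJet μ M a m x).2.1 j i
        = ∑ i, ξ i * ∑ j, ξ j * partialDeriv S (partialDeriv S v i) j x + ε * (1 * C) := by
      simp only [jetOf, bumpJet, Prod.snd_add, Prod.smul_snd, Prod.fst_add, Prod.smul_fst,
        Pi.add_apply, Pi.smul_apply,
        smul_eq_mul, mul_add, Finset.sum_add_distrib, hC, Finset.mul_sum]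
      congr 1
      refine Finset.sum_congr rfl fun i _ => Finset.sum_congr rfl fun j _ => by ring
    rw [e]
    exact h2

theorem jet_touch_normal {d : ℕ} {u v : Space d → ℝ}
    (hu : DifferentiableOn ℝ u (puncturedHalfBall d))
    (hv : DifferentiableOn ℝ v (puncturedHalfBall d)) {x : Space d}
    (hx : x ∈ flatBoundary d \ {0}) {μ M ε m : ℝ} {a : Fin (d + 1) → ℝ}
    (hmin : ∀ᶠ t in 𝓝[≥] (0 : ℝ), u x - (v x + ε * bump μ M a m x)
      ≤ u (x + t • EuclideanSpace.single (Fin.last d) (1 : ℝ))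
        - (v (x + t • EuclideanSpace.single (Fin.last d) (1 : ℝ))
          + ε * bump μ M a m (x + t • EuclideanSpace.single (Fin.last d) (1 : ℝ)))) :
    (jetOf (puncturedHalfBall d) v x + ε • bumpJet μ M a m x).2.2 (Fin.last d)
      ≤ (jetOf (puncturedHalfBall d) u x).2.2 (Fin.last d) := by
  set e : Space d := EuclideanSpace.single (Fin.last d) (1 : ℝ) with he
  have hbump : HasDerivAt (fun t : ℝ => bump μ M a m (x + t • e))
      (bumpGrad μ M a x (Fin.last d)) 0 := by
    simp only [bump_line]
    have hs : ∑ i, e i * bumpGrad μ M a x i = bumpGrad μ M a x (Fin.last d) := by simp [he]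
    rw [hs]
    refine ((((hasDerivAt_id (0 : ℝ)).mul_const _).const_add _).add
      (((hasDerivAt_pow 2 (0 : ℝ)).div_const 2).mul_const _)).congr_deriv ?_
    simp
  have hq := (hasDerivWithinAt_normal hv hx).add (hbump.hasDerivWithinAt.const_mul ε)
  exact normal_touch hu hx hq (by simpa using hmin)

end SigmaK

/-! ### Strict perturbations of v and the cone below u. -/

namespace SigmaK

open Matrix

/-- Near the origin, adding a small multiple of a suitable quadratic function to `v` makes both
operators strictly smaller. -/
theorem exists_strict_perturbation {d k l : ℕ} (hl : 1 ≤ l) (hlk : l ≤ k) (hk : k ≤ d + 1) (p : ℝ)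
    {v : Space d → ℝ} (hv : ContDiffOn ℝ 2 v (closedHalfBall d))
    (hv0 : PosCone k
      (schout (jetOf (closedHalfBall d) v 0).2.1 (jetOf (closedHalfBall d) v 0).2.2)) :
    ∃ μ M : ℝ, ∃ r > 0, ∃ ε₀ > (0 : ℝ), ∀ x ∈ closedHalfBall d, ‖x‖ < r →
      ∀ a : Fin (d + 1) → ℝ, ‖a‖ < r → ∀ m : ℝ, |m| < r → ∀ ε ∈ Set.Ioo 0 ε₀,
        interiorOp p k (jetOf (closedHalfBall d) v x + ε • bumpJet μ M a m x)
            < interiorOp p k (jetOf (closedHalfBall d) v x) ∧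
        boundaryOp l (jetOf (closedHalfBall d) v x + ε • bumpJet μ M a m x)
            < boundaryOp l (jetOf (closedHalfBall d) v x) ∧
        ∀ i ≤ l - 1, 0 < esig i
          (schoutTang (jetOf (closedHalfBall d) v x + ε • bumpJet μ M a m x).2.1
              (jetOf (closedHalfBall d) v x + ε • bumpJet μ M a m x).2.2
            + (-((jetOf (closedHalfBall d) v x + ε • bumpJet μ M a m x).2.2 (Fin.last d) ^ 2 / 2))
              • 1) := by
  set S := closedHalfBall d with hS
  obtain ⟨μ, M, h1, h2⟩ := exists_barrier_direction hl hlk hk p hv0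
  have h0S : (0 : Space d) ∈ S := ⟨by simp, by simp⟩
  obtain ⟨ε₁, hε₁, H1⟩ := eventually_add_smul_lt (contDiff_interiorOp p k) h1
  obtain ⟨ε₂, hε₂, H2⟩ := eventually_add_smul_lt (contDiff_boundaryOp l) h2
  have hopen : ∀ᶠ j : Jet d in 𝓝 (jetOf S v 0), ∀ i ∈ Finset.range (l - 1 + 1), 0 < esig i
      (schoutTang j.2.1 j.2.2 + (-(j.2.2 (Fin.last d) ^ 2 / 2)) • 1) := by
    refine (Finset.eventually_all _).2 fun i hi => ?_
    refine (contDiff_esig_schoutTang i).continuous.continuousAt.eventually_const_lt ?_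
    exact ((hv0.mono hlk).schoutTang hl (hlk.trans hk)).2 i
      (Nat.lt_succ_iff.1 (Finset.mem_range.1 hi))
  obtain ⟨ε₃, hε₃, H3⟩ := eventually_add_smul_mem hopen
    ((0, barrierHess d M, μ • Pi.single (Fin.last d) 1) : Jet d)
  set Φ : Space d × (Fin (d + 1) → ℝ) × ℝ → Jet d × Jet d :=
    fun q => (jetOf S v q.1, bumpJet μ M q.2.1 q.2.2 q.1) with hΦ
  -- At x = 0, a = 0, m = 0 the jet of the bump is exactly the decreasing direction; continuity
  -- extends the estimates to small x, a, m.
  have hΦ0 : Φ (0, 0, 0) = (jetOf S v 0, (0, barrierHess d M, μ • Pi.single (Fin.last d) 1)) := by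
    simp only [hΦ, bumpJet, bump, Prod.mk.injEq, true_and]
    refine ⟨by simp, ?_⟩
    ext i
    simp [bumpGrad, Pi.single_apply]
  have hc : ContinuousWithinAt Φ (S ×ˢ Set.univ) (0, 0, 0) := by
    refine ContinuousWithinAt.prodMk ?_ (continuous_bumpJet μ M).continuousWithinAt
    have hj := continuousOn_jetOf (uniqueDiffOn_closedHalfBall d) hv 0 h0S
    exact ContinuousWithinAt.comp (f := fun q : Space d × (Fin (d + 1) → ℝ) × ℝ => q.1)
      (x := (0, 0, 0)) hj continuous_fst.continuousWithinAt fun q hq => hq.1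
  have hev := hc.eventually (by rw [hΦ0]; exact (H1.and (H2.and H3)))
  obtain ⟨r, hr, hsub⟩ := Metric.mem_nhdsWithin_iff.1 hev
  refine ⟨μ, M, r, hr, min ε₁ (min ε₂ ε₃), lt_min hε₁ (lt_min hε₂ hε₃),
    fun x hx hxr a ha m hm ε hε => ?_⟩
  obtain ⟨g1, g2, g3⟩ := hsub (a := (x, a, m)) ⟨by
    rw [mem_ball_iff_norm, Prod.mk_sub_mk, Prod.mk_sub_mk, sub_zero, sub_zero, sub_zero,
      Prod.norm_def, Prod.norm_def]
    exact max_lt hxr (max_lt ha hm), ⟨hx, Set.mem_univ _⟩⟩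
  refine ⟨g1 ε ⟨hε.1, hε.2.trans_le (min_le_left _ _)⟩,
    g2 ε ⟨hε.1, hε.2.trans_le ((min_le_right _ _).trans (min_le_left _ _))⟩, fun i hi => ?_⟩
  exact g3 ε ⟨hε.1, hε.2.trans_le ((min_le_right _ _).trans (min_le_right _ _))⟩ i
    (Finset.mem_range.2 (Nat.lt_succ_iff.2 hi))

/-- If `u > v` in the half ball, then `u - v` is bounded below by a positive constant on the part
of a half sphere that stays away from the flat boundary. -/
theorem exists_lower_bound_on_sphere {d : ℕ} {f : Space d → ℝ}
    (hf : ContinuousOn f (puncturedHalfBall d)) (hpos : ∀ x ∈ halfBall d, 0 < f x) {r σ : ℝ}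
    (hr1 : r < 1) (hσ : 0 < σ) :
    ∃ c > 0, ∀ x : Space d, ‖x‖ = r → σ ≤ x (Fin.last d) → c ≤ f x := by
  set K : Set (Space d) := {x | ‖x‖ = r} ∩ {x | σ ≤ x (Fin.last d)} with hK
  have hKB : K ⊆ halfBall d := by
    rintro x ⟨h1, h2⟩
    rw [Set.mem_ofPred_eq] at h1 h2
    exact ⟨by linarith, by linarith⟩
  have hKc : IsCompact K := by
    apply Metric.isCompact_of_isClosed_isBounded
    · exact (isClosed_eq continuous_norm continuous_const).inter (isClosed_le continuous_const
        (by fun_prop : Continuous fun y : Space d => y (Fin.last d)))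
    · exact (Metric.isBounded_closedBall (x := (0 : Space d)) (r := r)).subset fun x hx => by
        simpa using le_of_eq hx.1
  rcases K.eq_empty_or_nonempty with h | h
  · refine ⟨1, one_pos, fun x h1 h2 => ?_⟩
    have : x ∈ K := ⟨h1, h2⟩
    rw [h] at this
    exact this.elim
  · obtain ⟨y, hy, hmin⟩ := hKc.exists_isMinOn h (hf.mono (hKB.trans (halfBall_subset d)))
    exact ⟨f y, hpos y (hKB hy), fun x h1 h2 => hmin (a := x) ⟨h1, h2⟩⟩

theorem nonneg_of_pos_on_halfBall {d : ℕ} {f : Space d → ℝ}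
    (hf : ContinuousOn f (puncturedHalfBall d)) (hpos : ∀ x ∈ halfBall d, 0 < f x) :
    ∀ x ∈ puncturedHalfBall d, 0 ≤ f x := by
  intro x hx
  have hcl : x ∈ closure (halfBall d) := by rw [closure_halfBall]; exact hx.1
  have := mem_closure_iff_nhdsWithin_neBot.1 hcl
  have ht : Filter.Tendsto f (𝓝[halfBall d] x) (𝓝 (f x)) :=
    (hf x hx).mono (halfBall_subset d)
  exact ge_of_tendsto ht (by filter_upwards [self_mem_nhdsWithin] with y hy using (hpos y hy).le)

theorem abs_sum_mul_le {d : ℕ} (a : Fin (d + 1) → ℝ) (x : Space d) :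
    |∑ i, a i * x i| ≤ (d + 1) * ‖a‖ * ‖x‖ := by
  refine (Finset.abs_sum_le_sum_abs _ _).trans ?_
  have : ∀ i ∈ (Finset.univ : Finset (Fin (d + 1))), |a i * x i| ≤ ‖a‖ * ‖x‖ := fun i _ => by
    rw [abs_mul]
    exact mul_le_mul (norm_le_pi_norm a i) (abs_apply_le_norm x i) (abs_nonneg _) (norm_nonneg _)
  refine (Finset.sum_le_sum this).trans (le_of_eq ?_)
  simp
  ring

/-- The quadratic function is nonpositive where a sphere is close to the flat boundary. -/
theorem bump_nonpos_near_equator {d : ℕ} {μ M r σ : ℝ} (hσ1 : σ ≤ 1)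
    (hσr : (|μ| + |M|) * σ ≤ r ^ 2 / 2) {a : Fin (d + 1) → ℝ} (ha : (d + 1) * ‖a‖ ≤ r / 2)
    (hr : 0 ≤ r) {x : Space d} (hx0 : 0 ≤ x (Fin.last d)) (hxσ : x (Fin.last d) ≤ σ)
    (hxr : ‖x‖ = r) : bump μ M a 0 x ≤ 0 := by
  have h1 : μ * x (Fin.last d) ≤ |μ| * σ := mul_le_mul (le_abs_self _) hxσ hx0 (abs_nonneg _)
  have h2 : M * x (Fin.last d) ^ 2 ≤ |M| * σ :=
    mul_le_mul (le_abs_self _) (by nlinarith) (sq_nonneg _) (abs_nonneg _)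
  have h3 := (abs_le.1 (abs_sum_mul_le a x)).2
  have h4 : (d + 1) * ‖a‖ * ‖x‖ ≤ r / 2 * r := by
    rw [hxr]; exact mul_le_mul_of_nonneg_right ha hr
  rw [bump, hxr]
  linarith

/-- A strict perturbation of `v` cannot touch `u` from below away from the origin. -/
theorem not_touch_of_strict {d k l : ℕ} (hl : 1 ≤ l) (hlk : l ≤ k) (hk : k ≤ d + 1) (p : ℝ)
    {u v : Space d → ℝ}
    (hu : ContDiffOn ℝ 2 u (puncturedHalfBall d)) (hv : ContDiffOn ℝ 2 v (closedHalfBall d))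
    (hAu : ∀ x ∈ puncturedHalfBall d, PosCone k
      (schout (jetOf (puncturedHalfBall d) u x).2.1 (jetOf (puncturedHalfBall d) u x).2.2))
    (hAv : ∀ x ∈ closedHalfBall d, PosCone k
      (schout (jetOf (closedHalfBall d) v x).2.1 (jetOf (closedHalfBall d) v x).2.2))
    (hint : ∀ x ∈ halfBall d, interiorOp p k (jetOf (closedHalfBall d) v x)
      ≤ interiorOp p k (jetOf (puncturedHalfBall d) u x))
    (hbdry : ∀ x ∈ flatBoundary d \ {0}, boundaryOp l (jetOf (closedHalfBall d) v x)
      ≤ boundaryOp l (jetOf (puncturedHalfBall d) u x))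
    (hbdry0 : ∀ x ∈ flatBoundary d \ {0}, 0 ≤ boundaryOp l (jetOf (closedHalfBall d) v x))
    {x : Space d} (hx : x ∈ puncturedHalfBall d) (hx1 : ‖x‖ < 1) {μ M ε m : ℝ}
    {a : Fin (d + 1) → ℝ}
    (h_int : interiorOp p k (jetOf (closedHalfBall d) v x + ε • bumpJet μ M a m x)
      < interiorOp p k (jetOf (closedHalfBall d) v x))
    (h_bdry : boundaryOp l (jetOf (closedHalfBall d) v x + ε • bumpJet μ M a m x)
      < boundaryOp l (jetOf (closedHalfBall d) v x))
    (h_cone : ∀ i ≤ l - 1, 0 < esig i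
      (schoutTang (jetOf (closedHalfBall d) v x + ε • bumpJet μ M a m x).2.1
          (jetOf (closedHalfBall d) v x + ε • bumpJet μ M a m x).2.2
        + (-((jetOf (closedHalfBall d) v x + ε • bumpJet μ M a m x).2.2 (Fin.last d) ^ 2 / 2))
          • 1))
    (hval : u x = v x + ε * bump μ M a m x) :
    ¬ ∀ᶠ y in 𝓝 x, y ∈ puncturedHalfBall d → v y + ε * bump μ M a m y ≤ u y := by
  intro hmin
  set S := puncturedHalfBall d with hS
  have hv' : ContDiffOn ℝ 2 v S := hv.mono Set.sdiff_subset
  rw [← jetOf_punctured hx] at h_int h_bdry h_cone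
  set j₁ := jetOf S u x with hj₁
  set j₂ := jetOf S v x + ε • bumpJet μ M a m x with hj₂
  have hval' : j₁.1 = j₂.1 := hval
  have hvC := hAv x hx.1
  rw [← jetOf_punctured hx] at hvC
  have hsym : ∀ i i', j₂.2.1 i i' = j₂.2.1 i' i := by
    intro i i'
    have h1 := symm_of_schout_isHermitian hvC.1 i i'
    have h2 := barrierHess_symm (d := d) M i i'
    change (jetOf S v x).2.1 i i' + ε * barrierHess d M i i'
      = (jetOf S v x).2.1 i' i + ε * barrierHess d M i' i
    rw [h1, h2]
  have hnear : ∀ ξ : Space d, ∀ᶠ t in 𝓝 (0 : ℝ), x + t • ξ ∈ S →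
      v (x + t • ξ) + ε * bump μ M a m (x + t • ξ) ≤ u (x + t • ξ) := fun ξ => by
    have hc : Continuous fun t : ℝ => x + t • ξ := by fun_prop
    have ht : Filter.Tendsto (fun t : ℝ => x + t • ξ) (𝓝 0) (𝓝 x) := by
      simpa using hc.tendsto 0
    exact ht.eventually hmin
  have hline : ∀ ξ : Space d, (∀ᶠ t in 𝓝 (0 : ℝ), x + t • ξ ∈ S) →
      ∑ i, ξ i * j₁.2.2 i = ∑ i, ξ i * j₂.2.2 i ∧
      ∑ i, ξ i * ∑ i', ξ i' * j₂.2.1 i' i ≤ ∑ i, ξ i * ∑ i', ξ i' * j₁.2.1 i' i := by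
    intro ξ hξ
    refine jet_touch_line (uniqueDiffOn_puncturedHalfBall d) hu hv' hξ ?_
    filter_upwards [hξ, hnear ξ] with t ht1 ht2
    linarith [ht2 ht1]
  have hsingle : ∀ (i : Fin (d + 1)) (g : Fin (d + 1) → ℝ),
      ∑ i', (EuclideanSpace.single i (1 : ℝ)) i' * g i' = g i := fun i g => by simp
  rcases hx.1.2.lt_or_eq with hn | hn
  · have hxB : x ∈ halfBall d := ⟨hx1, hn⟩
    have hT := fun ξ : Space d => (eventually_line_mem_of_halfBall hxB ξ).mono
      fun t ht => halfBall_subset d ht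
    have hle := interiorOp_le_of_touch hk p (hAu x hx) hsym hval' (by
      ext i
      have := (hline _ (hT (EuclideanSpace.single i 1))).1
      rwa [hsingle, hsingle] at this) fun ξ => (hline (WithLp.toLp 2 ξ) (hT _)).2
    have h1 := hint x hxB
    rw [← jetOf_punctured hx] at h1
    -- Interior contact would give F[v + ε q] < F[v] ≤ F[u] ≤ F[v + ε q].
    exact absurd (h_int.trans_le (h1.trans hle)) (lt_irrefl _)
  · have hxF : x ∈ flatBoundary d \ {0} := ⟨⟨hx1, hn.symm⟩, hx.2⟩
    have h1 := hbdry x hxF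
    have h0 := hbdry0 x hxF
    rw [← jetOf_punctured hx] at h1 h0
    have hle := boundaryOp_le_of_touch hl (hlk.trans hk) ((hAu x hx).mono hlk) (h0.trans h1) hsym
      h_cone hval' (fun i => by
        have := (hline _ (eventually_line_mem_of_flat hxF
          (ξ := EuclideanSpace.single i.castSucc 1) (by simp))).1
        rwa [hsingle, hsingle] at this)
      (jet_touch_normal (hu.differentiableOn two_ne_zero) (hv'.differentiableOn two_ne_zero) hxF
        (by
          filter_upwards [eventually_line_mem_normal hxF, nhdsWithin_le_nhds (hnear _)]
            with t ht1 ht2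
          linarith [ht2 ht1]))
      fun ξ hξ => (hline (WithLp.toLp 2 ξ) (eventually_line_mem_of_flat hxF hξ)).2
    exact absurd (h_bdry.trans_le (h1.trans hle)) (lt_irrefl _)

/-- A cone around a perturbation of `v` lies below `u` near the origin. -/
theorem exists_cone_below {d k l : ℕ} (hl : 1 ≤ l) (hlk : l ≤ k) (hk : k ≤ d + 1) (p : ℝ)
    {u v : Space d → ℝ}
    (hu : ContDiffOn ℝ 2 u (puncturedHalfBall d)) (hv : ContDiffOn ℝ 2 v (closedHalfBall d))
    (hAu : ∀ x ∈ puncturedHalfBall d, PosCone k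
      (schout (jetOf (puncturedHalfBall d) u x).2.1 (jetOf (puncturedHalfBall d) u x).2.2))
    (hAv : ∀ x ∈ closedHalfBall d, PosCone k
      (schout (jetOf (closedHalfBall d) v x).2.1 (jetOf (closedHalfBall d) v x).2.2))
    (hint : ∀ x ∈ halfBall d, interiorOp p k (jetOf (closedHalfBall d) v x)
      ≤ interiorOp p k (jetOf (puncturedHalfBall d) u x))
    (hbdry : ∀ x ∈ flatBoundary d \ {0}, boundaryOp l (jetOf (closedHalfBall d) v x)
      ≤ boundaryOp l (jetOf (puncturedHalfBall d) u x))
    (hbdry0 : ∀ x ∈ flatBoundary d \ {0}, 0 ≤ boundaryOp l (jetOf (closedHalfBall d) v x))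
    (huv : ∀ x ∈ halfBall d, v x < u x) :
    ∃ μ M ε α r : ℝ, 0 < ε ∧ 0 < α ∧ 0 < r ∧ r < 1 ∧
      ∀ x ∈ puncturedHalfBall d, ‖x‖ ≤ r → v x + ε * (bump μ M 0 0 x + α * ‖x‖) ≤ u x := by
  set S := puncturedHalfBall d with hS
  obtain ⟨μ, M, r₀, hr₀, ε₀, hε₀, hpert⟩ :=
    exists_strict_perturbation hl hlk hk p hv (hAv 0 ⟨by simp, by simp⟩)
  have hv' : ContDiffOn ℝ 2 v S := hv.mono Set.sdiff_subset
  have hfc : ContinuousOn (fun x => u x - v x) S := hu.continuousOn.sub hv'.continuousOn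
  have hge := nonneg_of_pos_on_halfBall hfc fun x hx => sub_pos.2 (huv x hx)
  have hd0 : (0 : ℝ) ≤ d := Nat.cast_nonneg d
  set C : ℝ := 2 + |μ| + |M| + d with hC
  have hC2 : 2 ≤ C := by linarith [abs_nonneg μ, abs_nonneg M]
  -- C bounds |bump|/|x|. The choice gives C r < r₀, which keeps the later shift m within the range
  -- of the strict perturbation.
  set r : ℝ := min 1 r₀ / (2 * C) with hr
  have hmin0 : 0 < min 1 r₀ := lt_min one_pos hr₀
  have hr0 : 0 < r := by positivity
  have hCr : C * r = min 1 r₀ / 2 := by rw [hr]; field_simp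
  have hCr1 : C * r < r₀ := by rw [hCr]; linarith [min_le_right 1 r₀]
  have hrC : r ≤ C * r / 2 := by nlinarith
  have hr1 : r < 1 := by linarith [min_le_left 1 r₀]
  have hrr₀ : r < r₀ := by linarith
  -- On |x| = r with x_n ≤ σ the terms in μ and M use at most r²/2, and α below lets the linear term
  -- use the other r²/2 of -|x|². So the bump is nonpositive there, where u - v has no positive
  -- lower bound.
  obtain ⟨σ, hσ0, hσ1, hσr⟩ : ∃ σ > 0, σ ≤ 1 ∧ (|μ| + |M|) * σ ≤ r ^ 2 / 2 := by
    have hden : 0 < |μ| + |M| + 1 := by positivity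
    refine ⟨min 1 (r ^ 2 / (2 * (|μ| + |M| + 1))), lt_min one_pos (by positivity),
      min_le_left _ _, ?_⟩
    have h0 : 0 < min 1 (r ^ 2 / (2 * (|μ| + |M| + 1))) := lt_min one_pos (by positivity)
    have h1 : min 1 (r ^ 2 / (2 * (|μ| + |M| + 1))) ≤ r ^ 2 / (2 * (|μ| + |M| + 1)) :=
      min_le_right _ _
    rw [le_div_iff₀ (by positivity)] at h1
    linarith
  obtain ⟨c, hc, hlow⟩ := exists_lower_bound_on_sphere hfc (fun x hx => sub_pos.2 (huv x hx))
    hr1 hσ0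
  set α : ℝ := r / (2 * (d + 1)) with hα
  have hα0 : 0 < α := by positivity
  have hαd : (d + 1) * α = r / 2 := by rw [hα]; field_simp
  have hαr : α ≤ r := by nlinarith
  have hCr0 : 0 < C * r := by positivity
  -- On the rest of the sphere u - v ≥ c, and ε times the bump stays below c.
  obtain ⟨ε, hε0, hεε, hεc⟩ : ∃ ε > 0, ε ∈ Set.Ioo 0 ε₀ ∧ ε * (C * r) ≤ c := by
    have h0 : 0 < min (ε₀ / 2) (c / (C * r)) := lt_min (by positivity) (by positivity)
    refine ⟨min (ε₀ / 2) (c / (C * r)), h0, ⟨h0, (min_le_left _ _).trans_lt (by linarith)⟩, ?_⟩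
    exact (le_div_iff₀ hCr0).1 (min_le_right _ _)
  have main : ∀ a : Fin (d + 1) → ℝ, ‖a‖ ≤ α → ∀ x ∈ S, ‖x‖ ≤ r →
      v x + ε * bump μ M a 0 x ≤ u x := by
    intro a ha y hy hyr
    by_contra! hlt
    have hbound : ∀ x : Space d, ‖x‖ ≤ r → ε * bump μ M a 0 x ≤ ε * (C * ‖x‖) := fun x hx =>
      mul_le_mul_of_nonneg_left
        (abs_le.1 (abs_bump_le μ M a x (by linarith) (by linarith))).2 hε0.le
    set f : Space d → ℝ := fun x => u x - (v x + ε * bump μ M a 0 x) with hf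
    have hfy : f y < 0 := sub_neg.2 hlt
    have hfge : ∀ x ∈ S, -(ε * bump μ M a 0 x) ≤ f x := fun x hx => by
      have : 0 ≤ u x - v x := hge x hx
      change _ ≤ u x - (v x + ε * bump μ M a 0 x)
      linarith
    have hfcont : ContinuousOn f S := by
      refine hu.continuousOn.sub (hv'.continuousOn.add ?_)
      have : Continuous fun x : Space d => ε * bump μ M a 0 x := by unfold bump; fun_prop
      exact this.continuousOn
    obtain ⟨x, hx, hxr, hxy, hxmin⟩ := exists_min_of_lt_near_zero (R := r) hfcont hy hyr (by
      refine ⟨min r (-f y / (ε * C)), lt_min hr0 (div_pos (by linarith) (by positivity)),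
        fun x hx hxρ => ?_⟩
      have h1 := hbound x (hxρ.trans_le (min_le_left _ _)).le
      have h2 : ‖x‖ < -f y / (ε * C) := hxρ.trans_le (min_le_right _ _)
      rw [lt_div_iff₀ (by positivity)] at h2
      linarith [hfge x hx])
    have hfx : f x < 0 := hxy.trans_lt hfy
    have hbx := hbound x hxr
    have hfgx := hfge x hx
    have hxlt : ‖x‖ < r := by
      refine hxr.lt_of_ne fun hxr => ?_
      rcases le_total σ (x (Fin.last d)) with hcase | hcase
      · have h1 : c ≤ u x - v x := hlow x hxr hcase
        have h2 : u x - (v x + ε * bump μ M a 0 x) < 0 := hfx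
        rw [hxr] at hbx
        linarith
      · have h5 := bump_nonpos_near_equator (a := a) hσ1 hσr
          ((mul_le_mul_of_nonneg_left ha (by linarith)).trans hαd.le) hr0.le hx.1.2 hcase hxr
        linarith [mul_nonpos_of_nonneg_of_nonpos hε0.le h5]
    -- The shift by the negative minimum value turns the minimum into a contact point with u.
    set m : ℝ := f x / ε with hm
    have hmε : ε * m = f x := by rw [hm]; field_simp
    have hm_lt : |m| < r₀ := by
      have h2 : -(C * ‖x‖) ≤ m := le_of_mul_le_mul_left (by rw [hmε]; linarith) hε0
      have h3 : m < 0 := div_neg_of_neg_of_pos hfx hε0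
      have h4 : C * ‖x‖ ≤ C * r := mul_le_mul_of_nonneg_left hxr (by linarith)
      rw [abs_lt]
      constructor <;> linarith
    have hfm : ∀ z : Space d, u z - (v z + ε * bump μ M a m z) = f z - f x := fun z => by
      have : bump μ M a m z = bump μ M a 0 z + m := by simp [bump]
      rw [this, mul_add, hmε]
      simp only [hf]
      ring
    obtain ⟨g1, g2, g3⟩ := hpert x hx.1 (hxlt.trans hrr₀) a ((ha.trans hαr).trans_lt hrr₀) m hm_lt
      ε hεε
    refine not_touch_of_strict hl hlk hk p hu hv hAu hAv hint hbdry hbdry0 hx (hxlt.trans hr1)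
      g1 g2 g3 (by have := hfm x; linarith) ?_
    filter_upwards [continuous_norm.continuousAt.eventually_lt_const hxlt] with z hz hzS
    have h1 := hfm z
    have h2 := hxmin z hzS hz.le
    linarith
  refine ⟨μ, M, ε, α, r, hε0, hα0, hr0, hr1, fun x hx hxr => ?_⟩
  have hpos := norm_pos_iff.2 hx.2
  -- The direction is chosen depending on x: the envelope over a of the linear terms contains the
  -- cone α |x|.
  have h := main (fun i => α * (x i / ‖x‖)) (by
    refine (pi_norm_le_iff_of_nonneg hα0.le).2 fun i => ?_
    rw [Real.norm_eq_abs, abs_mul, abs_of_pos hα0, abs_div (x i), abs_norm]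
    exact mul_le_of_le_one_right hα0.le ((div_le_one hpos).2 (abs_apply_le_norm x i))) x hx hxr
  refine le_trans (le_of_eq ?_) h
  have e : ∑ i, α * (x i / ‖x‖) * x i = α * ‖x‖ := by
    have h1 : ∑ i, α * (x i / ‖x‖) * x i = α / ‖x‖ * ∑ i, x i ^ 2 := by
      rw [Finset.mul_sum]
      exact Finset.sum_congr rfl fun i _ => by ring
    rw [h1, ← EuclideanSpace.real_norm_sq_eq]
    field_simp
  simp only [bump, e]
  simp

end SigmaK

/-! ### The theorem: expansion of v at the origin and conclusion. -/

theorem proposition3p1 (d k l : ℕ) (hl : 2 ≤ l) (hlk : l ≤ k) (hk : 2 * k ≤ d + 1) (p : ℝ)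
    (u v : SigmaK.Space d → ℝ)
    (hu : ContDiffOn ℝ 2 u (SigmaK.closedHalfBall d \ {0}))
    (hv : ContDiffOn ℝ 2 v (SigmaK.closedHalfBall d))
    (hAu : ∀ x ∈ SigmaK.closedHalfBall d \ {0},
      SigmaK.confHess (SigmaK.closedHalfBall d \ {0}) u x ∈ SigmaK.Gam k)
    (hAv : ∀ x ∈ SigmaK.closedHalfBall d,
      SigmaK.confHess (SigmaK.closedHalfBall d) v x ∈ SigmaK.Gam k)
    (hsigma : ∀ x ∈ SigmaK.halfBall d,
      Real.exp (p * v x) * SigmaK.sigma k (SigmaK.confHess (SigmaK.closedHalfBall d) v x) ≤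
        Real.exp (p * u x) *
          SigmaK.sigma k (SigmaK.confHess (SigmaK.closedHalfBall d \ {0}) u x))
    (hBuv : ∀ x ∈ SigmaK.flatBoundary d \ {0},
      SigmaK.boundaryB (SigmaK.closedHalfBall d) l v x ≤
        SigmaK.boundaryB (SigmaK.closedHalfBall d \ {0}) l u x)
    (hBv : ∀ x ∈ SigmaK.flatBoundary d \ {0},
      0 ≤ SigmaK.boundaryB (SigmaK.closedHalfBall d) l v x)
    (huv : ∀ x ∈ SigmaK.halfBall d, v x < u x) :
    0 < Filter.liminf (fun x => ((u x - v x : ℝ) : EReal))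
      (𝓝[SigmaK.closedHalfBall d \ {0}] 0) := by
  open SigmaK in
  have hkd : k ≤ d + 1 := by omega
  have hld : l ≤ d + 1 := by omega
  have hd : 1 ≤ d := by omega
  have hAu' : ∀ x ∈ puncturedHalfBall d, PosCone k
      (schout (jetOf (puncturedHalfBall d) u x).2.1 (jetOf (puncturedHalfBall d) u x).2.2) :=
    fun x hx => posCone_schout hkd (hAu x hx)
  have hAv' : ∀ x ∈ closedHalfBall d, PosCone k
      (schout (jetOf (closedHalfBall d) v x).2.1 (jetOf (closedHalfBall d) v x).2.2) :=
    fun x hx => posCone_schout hkd (hAv x hx)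
  have hbv : ∀ x ∈ flatBoundary d \ {0},
      0 ≤ boundaryOp l (jetOf (closedHalfBall d) v x) := fun x hx => by
    rw [← boundaryB_eq_boundaryOp hld (hAv x (flatBoundary_subset d hx).1).1]
    exact hBv x hx
  have hbuv : ∀ x ∈ flatBoundary d \ {0}, boundaryOp l (jetOf (closedHalfBall d) v x)
      ≤ boundaryOp l (jetOf (puncturedHalfBall d) u x) := fun x hx => by
    rw [← boundaryB_eq_boundaryOp hld (hAv x (flatBoundary_subset d hx).1).1,
      ← boundaryB_eq_boundaryOp hld (hAu x (flatBoundary_subset d hx)).1]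
    exact hBuv x hx
  obtain ⟨μ, M, ε, α, r, hε, hα, hr, hr1, hcone⟩ := exists_cone_below (by omega) hlk hkd p hu hv
    hAu' hAv' (fun x hx => by
      have hx' := halfBall_subset d hx
      rw [← exp_mul_sigma_confHess hkd (hAv x hx'.1), ← exp_mul_sigma_confHess hkd (hAu x hx')]
      exact hsigma x hx) hbuv hbv huv
  set g : Fin (d + 1) → ℝ := fun i => partialDeriv (closedHalfBall d) v i 0 with hg
  have h0S : (0 : Space d) ∈ closedHalfBall d := ⟨by simp, by simp⟩
  have hdiff := (hv.differentiableOn two_ne_zero 0 h0S).hasFDerivWithinAt.isLittleO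
  have hlin : ∀ η > 0, ∃ ρ > 0, ∀ x ∈ closedHalfBall d, ‖x‖ < ρ →
      |v x - v 0 - ∑ i, g i * x i| ≤ η * ‖x‖ := by
    intro η hη
    obtain ⟨ρ, hρ, hsub⟩ := Metric.mem_nhdsWithin_iff.1 (hdiff.def hη)
    refine ⟨ρ, hρ, fun x hx hxρ => ?_⟩
    have h := hsub ⟨by simpa using hxρ, hx⟩
    simp only [Set.mem_ofPred_eq, sub_zero, fderivWithin_eq_sum, Real.norm_eq_abs] at h
    simpa [hg, mul_comm] using h
  -- Of the slope εα, a quarter pays for the quadratic terms of the bump and a quarter, δ/2, for the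
  -- Taylor remainder of v; δ is what remains.
  set δ := ε * α / 2 with hδ
  have hδ0 : 0 < δ := by positivity
  obtain ⟨ρ₁, hρ₁, hlin₁⟩ := hlin (δ / 2) (by positivity)
  set R := min r (min (ρ₁ / 2) (α / (4 * (1 + |M|)))) with hR
  have hR0 : 0 < R := lt_min hr (lt_min (by positivity) (by positivity))
  have hcone' : ∀ x ∈ puncturedHalfBall d, ‖x‖ ≤ R →
      v 0 + ∑ i, (g i + (if i = Fin.last d then ε * μ else 0)) * x i + δ * ‖x‖ ≤ u x := by
    intro x hx hxR
    have h1 := hcone x hx (hxR.trans (min_le_left _ _))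
    have h2 : ‖x‖ ≤ ρ₁ / 2 := hxR.trans ((min_le_right _ _).trans (min_le_left _ _))
    have h3 : ‖x‖ ≤ α / (4 * (1 + |M|)) := hxR.trans ((min_le_right _ _).trans (min_le_right _ _))
    have h4 := (abs_le.1 (hlin₁ x hx.1 (by linarith))).1
    rw [le_div_iff₀ (by positivity)] at h3
    have h5 : -((1 + |M|) * ‖x‖ ^ 2) ≤ -‖x‖ ^ 2 + M * x (Fin.last d) ^ 2 := by
      have h6 : x (Fin.last d) ^ 2 ≤ ‖x‖ ^ 2 :=
        sq_le_sq.2 ((abs_apply_le_norm x _).trans (le_abs_self _))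
      nlinarith [neg_abs_le M, abs_nonneg M, sq_nonneg (x (Fin.last d))]
    have h7 : (1 + |M|) * ‖x‖ ^ 2 ≤ α / 4 * ‖x‖ := by nlinarith [norm_nonneg x]
    have h8 : bump μ M 0 0 x
        = -‖x‖ ^ 2 + μ * x (Fin.last d) + M * x (Fin.last d) ^ 2 := by simp [bump]
    have h9 : ε * (μ * x (Fin.last d) - α / 4 * ‖x‖ + α * ‖x‖)
        ≤ ε * (bump μ M 0 0 x + α * ‖x‖) :=
      mul_le_mul_of_nonneg_left (by rw [h8]; linarith) hε.le
    have h10 : ∑ i, (g i + (if i = Fin.last d then ε * μ else 0)) * x i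
        = ∑ i, g i * x i + ε * μ * x (Fin.last d) := by
      simp only [add_mul, Finset.sum_add_distrib]
      simp
    rw [h10]
    rw [hδ] at h4 ⊢
    nlinarith [norm_nonneg x]
  obtain ⟨ρ, hρ, κ, hκ, hgap⟩ := gap_of_cone hd hu
    (fun x hx => laplacian_neg hd ((hAu' x (halfBall_subset d hx)).mono (by omega)))
    (fun x hx => normal_nonpos_of_boundaryOp_nonneg (l := l) (by omega) hld
      ((hAu' x (flatBoundary_subset d hx)).mono hlk) ((hbv x hx).trans (hbuv x hx)))
    hR0 ((min_le_left _ _).trans_lt hr1) hδ0 _ hcone'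
  set b : Fin (d + 1) → ℝ := fun i =>
    if i = Fin.last d then 0 else g i + (if i = Fin.last d then ε * μ else 0) with hb
  -- Only continuity of v is needed now: u - ⟨b, x⟩ ≥ v(0) + κ near 0 while v - ⟨b, x⟩ tends to
  -- v(0), even though b has lost its normal component.
  have hcont : ContinuousWithinAt (fun x => v x - ∑ i, b i * x i) (closedHalfBall d) 0 := by
    refine (hv.continuousOn 0 h0S).sub ?_
    exact (by fun_prop : Continuous fun x : Space d => ∑ i, b i * x i).continuousWithinAt
  have hev : ∀ᶠ x in 𝓝[closedHalfBall d \ {0}] 0, v x - ∑ i, b i * x i < v 0 + κ / 2 := by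
    have := (hcont.mono (Set.sdiff_subset (t := {0}))).eventually_lt_const
      (u := v 0 + κ / 2) (by simpa using hκ)
    exact this
  have hball : ∀ᶠ x in 𝓝[closedHalfBall d \ {0}] (0 : Space d), ‖x‖ < ρ :=
    nhdsWithin_le_nhds (continuous_norm.continuousAt.eventually_lt_const (by simpa using hρ))
  have hlim : ((κ / 2 : ℝ) : EReal) ≤ Filter.liminf (fun x => ((u x - v x : ℝ) : EReal))
      (𝓝[closedHalfBall d \ {0}] 0) := by
    refine Filter.le_liminf_of_le (by isBoundedDefault) ?_
    filter_upwards [hev, hball, self_mem_nhdsWithin] with x h1 h2 h3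
    have h4 := hgap x h3 h2.le
    rw [EReal.coe_le_coe_iff]
    linarith
  refine lt_of_lt_of_le ?_ hlim
  exact_mod_cast half_pos hκ
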